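/- Let $n\ge 0$, let $E$ be a complex vector space of dimension $2n+1$ and let $\omega\in\Lambda^2E^*$ be a skew-form of maximal rank $2n$. (The skew-forms of rank $2n$ form a dense Zariski open subset of $\Lambda^2E^*$, so this is a generic skew-form.) Let $1\le d_1<\dots<d_r\le n+1$ be integers, $r\ge 1$. Let $\mathbb F=\mathbb F(d_1,\dots,d_r,E)$ be the (type A) flag variety of all flags $V_{d_1}\subset\dots\subset V_{d_r}\subset E$ with $\dim V_{d_i}=d_i$, and let $F_\omega(d_1,\dots,d_r,E)\subset\mathbb F$ be the odd symplectic flag variety, the set of those flags all of whose members $V_{d_i}$ are isotropic for $\omega$. Then $F_\omega(d_1,\dots,d_r,E)$ is a nonempty Zariski closed subset of $\mathbb F$ and, with its reduced structure, it is a smooth subvariety of $\mathbb F$ of codimension $\frac12 d_r(d_r-1)$ at each of its points: for all $p\in F_\omega(d_1,\dots,d_r,E)$ the local ring $\mathcal O_{F_\omega,p}$ is regular and $\dim\mathcal O_{F_\omega,p}+\frac12d_r(d_r-1)=\dim\mathcal O_{\mathbb F,p}$. Moreover, let $T$ be the tautological bundle on $\mathbb F$ with fibre $V_{d_r}$ at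 $(V_{d_1}\subset\dots\subset V_{d_r})$. Then the restrictions $\omega|_{V_{d_r}}$ define a regular section of $\Lambda^2T^*$ whose zero locus is $F_\omega(d_1,\dots,d_r,E)$, also as a scheme: at each point of $F_\omega(d_1,\dots,d_r,E)$ the ideal of $F_\omega(d_1,\dots,d_r,E)$ in $\mathcal O_{\mathbb F,p}$ is generated by the components of this section. -/

import Mathlib

open Module Filter Topology

noncomputable section

namespace OddSymplectic

/-! ### The Zariski topology of a vector space -/

/-- Polynomial functions on a complex vector space `W`: the algebra of functions generated by the
linear functionals. -/
def polyFun (W : Type*) [AddCommGroup W] [Module ℂ W] : Subalgebra ℂ (W → ℂ) :=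
  Algebra.adjoin ℂ (Set.range fun l : Dual ℂ W => (l : W → ℂ))

/-- The Zariski topology on a complex vector space, generated by the basic open sets
`{P ≠ 0}`, `P` a polynomial function. -/
abbrev zariskiTopology (W : Type*) [AddCommGroup W] [Module ℂ W] : TopologicalSpace W :=
  TopologicalSpace.generateFrom {U | ∃ P ∈ polyFun W, U = {w | P w ≠ 0}}

/-! ### The type A flag manifold as an algebraic variety -/

/-- The flags `V_{d_0} ⊂ ⋯ ⊂ V_{d_r}` of subspaces of `E` with `dim V_{d_i} = d_i`
(there are `r + 1` of them). -/
@[ext]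
structure Flag {r : ℕ} (d : Fin (r + 1) → ℕ) (E : Type*) [AddCommGroup E] [Module ℂ E] where
  /-- the members of the flag -/
  V : Fin (r + 1) → Submodule ℂ E
  mono : Monotone V
  finrank_eq : ∀ i, finrank ℂ (V i) = d i

/-- An (ordered) basis of `E` together with the flag whose `i`-th member is spanned by the first
`d i` basis vectors. Since the basis determines the flag, these are just the bases of `E`, and
`x ↦ x.flag` is the quotient map from the bases (a torsor under `GL(E)`) to the flags `GL(E)/P`. -/
structure AdaptedBasis {r : ℕ} (d : Fin (r + 1) → ℕ) (E : Type*) [AddCommGroup E]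
    [Module ℂ E] where
  /-- the basis -/
  basis : Basis (Fin (finrank ℂ E)) ℂ E
  /-- the flag spanned by it -/
  flag : Flag d E
  adapted : ∀ i, flag.V i = Submodule.span ℂ (basis '' {j | (j : ℕ) < d i})

section

variable {r : ℕ} {d : Fin (r + 1) → ℕ} {E : Type*} [AddCommGroup E] [Module ℂ E]

/-- A basis of `E` as a point of the vector space `E ^ (dim E)`. -/
def AdaptedBasis.vec (x : AdaptedBasis d E) : Fin (finrank ℂ E) → E := fun j => x.basis j

/-- Bases of `E` carry the Zariski topology induced from `E ^ (dim E)`. -/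
instance : TopologicalSpace (AdaptedBasis d E) :=
  TopologicalSpace.induced AdaptedBasis.vec (zariskiTopology (Fin (finrank ℂ E) → E))

/-- The Zariski topology of the flag manifold: the quotient topology of `GL(E)/P`. -/
instance : TopologicalSpace (Flag d E) :=
  TopologicalSpace.coinduced AdaptedBasis.flag inferInstance

/-- The functions on the flag manifold that are regular on a neighbourhood of `p`. As for every
quotient variety, `f` is regular on the open set `U` if its pull-back to the inverse image of `U`
in the variety of bases is regular, that is, locally a quotient of polynomial functions. -/
def regularAt (p : Flag d E) : Subring (Flag d E → ℂ) where
  carrier := {f | ∃ U : Set (Flag d E), IsOpen U ∧ p ∈ U ∧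
    ∀ x : AdaptedBasis d E, x.flag ∈ U →
      ∃ P ∈ polyFun (Fin (finrank ℂ E) → E), ∃ Q ∈ polyFun (Fin (finrank ℂ E) → E),
        Q x.vec ≠ 0 ∧
        ∀ y : AdaptedBasis d E, y.flag ∈ U → Q y.vec ≠ 0 → f y.flag = P y.vec / Q y.vec}
  zero_mem' := ⟨Set.univ, isOpen_univ, trivial, fun x _ =>
    ⟨0, zero_mem _, 1, one_mem _, by simp, fun y _ _ => by simp⟩⟩
  one_mem' := ⟨Set.univ, isOpen_univ, trivial, fun x _ =>
    ⟨1, one_mem _, 1, one_mem _, by simp, fun y _ _ => by simp⟩⟩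
  add_mem' := by
    rintro f g ⟨U, hU, hpU, hf⟩ ⟨U', hU', hpU', hg⟩
    refine ⟨U ∩ U', hU.inter hU', ⟨hpU, hpU'⟩, fun x hx => ?_⟩
    obtain ⟨P, hP, Q, hQ, hx1, h1⟩ := hf x hx.1
    obtain ⟨P', hP', Q', hQ', hx2, h2⟩ := hg x hx.2
    refine ⟨P * Q' + Q * P', add_mem (mul_mem hP hQ') (mul_mem hQ hP'), Q * Q', mul_mem hQ hQ',
      mul_ne_zero hx1 hx2, fun y hy hne => ?_⟩
    obtain ⟨n1, n2⟩ := mul_ne_zero_iff.1 hne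
    rw [Pi.add_apply, h1 y hy.1 n1, h2 y hy.2 n2, div_add_div _ _ n1 n2]
    rfl
  mul_mem' := by
    rintro f g ⟨U, hU, hpU, hf⟩ ⟨U', hU', hpU', hg⟩
    refine ⟨U ∩ U', hU.inter hU', ⟨hpU, hpU'⟩, fun x hx => ?_⟩
    obtain ⟨P, hP, Q, hQ, hx1, h1⟩ := hf x hx.1
    obtain ⟨P', hP', Q', hQ', hx2, h2⟩ := hg x hx.2
    refine ⟨P * P', mul_mem hP hP', Q * Q', mul_mem hQ hQ', mul_ne_zero hx1 hx2,
      fun y hy hne => ?_⟩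
    obtain ⟨n1, n2⟩ := mul_ne_zero_iff.1 hne
    rw [Pi.mul_apply, h1 y hy.1 n1, h2 y hy.2 n2, div_mul_div_comm]
    rfl
  neg_mem' := by
    rintro f ⟨U, hU, hpU, hf⟩
    refine ⟨U, hU, hpU, fun x hx => ?_⟩
    obtain ⟨P, hP, Q, hQ, hx1, h1⟩ := hf x hx
    refine ⟨-P, neg_mem hP, Q, hQ, hx1, fun y hy hne => ?_⟩
    rw [Pi.neg_apply, h1 y hy hne, Pi.neg_apply, neg_div]

/-- The local ring `𝒪_{Z,p}` at `p ∈ Z` of a subset `Z` of the flag manifold, with its reduced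
structure: germs at `p` of functions on `Z` that are restrictions of regular functions.
For `Z = Set.univ` it is the local ring of the flag manifold. -/
def localRing (Z : Set (Flag d E)) (p : Flag d E) : Subring (Germ (𝓝[Z] p) ℂ) :=
  (regularAt p).map (Germ.coeRingHom (𝓝[Z] p))

/-- The ideal of `Z` in the local ring of the flag manifold at `p`: germs of regular functions that
vanish on `Z` near `p`. -/
def vanishingIdeal (Z : Set (Flag d E)) (p : Flag d E) : Ideal (localRing Set.univ p) where
  carrier := {g | ∃ f ∈ regularAt p,
    (g : Germ (𝓝[Set.univ] p) ℂ) = (f : Germ (𝓝[Set.univ] p) ℂ) ∧ ∀ᶠ q in 𝓝[Z] p, f q = 0}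
  zero_mem' := ⟨0, zero_mem _, rfl, by simp⟩
  add_mem' := by
    rintro a b ⟨f, hf, ha, hf0⟩ ⟨g, hg, hb, hg0⟩
    refine ⟨f + g, add_mem hf hg, by rw [Subring.coe_add, ha, hb]; rfl, ?_⟩
    filter_upwards [hf0, hg0] with q h1 h2
    simp [h1, h2]
  smul_mem' := by
    rintro ⟨c, f, hf, rfl⟩ b ⟨g, hg, hb, hg0⟩
    refine ⟨f * g, mul_mem hf hg, by rw [smul_eq_mul, Subring.coe_mul, hb]; rfl, ?_⟩
    filter_upwards [hg0] with q h2
    simp [h2]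

/-! ### The tautological bundle `T` of highest rank and sections of `Λ² T*` -/

/-- The fibre at `p` of the tautological bundle `T` of highest rank. -/
abbrev Flag.top (p : Flag d E) : Submodule ℂ E := p.V (Fin.last r)

/-- A section of `T` is regular near `p` if it is regular as a function with values in `E`. -/
def IsRegularSection (s : ∀ q : Flag d E, q.top) (p : Flag d E) : Prop :=
  ∀ l : Dual ℂ E, (fun q => l (s q : E)) ∈ regularAt p

/-- A section of `Λ² T*` is regular near `p` if its contraction with any two sections of `T` that
are regular near `p` is regular near `p`. -/
def IsRegularForm (σ : ∀ q : Flag d E, q.top [⋀^Fin 2]→ₗ[ℂ] ℂ) (p : Flag d E) : Prop :=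
  ∀ s t : ∀ q : Flag d E, q.top, IsRegularSection s p → IsRegularSection t p →
    (fun q => σ q ![s q, t q]) ∈ regularAt p

/-- The ideal, in the local ring of the flag manifold at `p`, of the scheme of zeros of a section
`σ` of `Λ² T*`: the image of the contraction `Λ² T → 𝒪` with `σ`. -/
def zeroSchemeIdeal (σ : ∀ q : Flag d E, q.top [⋀^Fin 2]→ₗ[ℂ] ℂ) (p : Flag d E) :
    Ideal (localRing Set.univ p) :=
  Ideal.span {g | ∃ s t : ∀ q : Flag d E, q.top, IsRegularSection s p ∧ IsRegularSection t p ∧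
    (g : Germ (𝓝[Set.univ] p) ℂ) = ((fun q => σ q ![s q, t q] : Flag d E → ℂ) :
      Germ (𝓝[Set.univ] p) ℂ)}

/-! ### Skew-forms and odd symplectic flag manifolds -/

/-- The rank of a skew-form on `E`: that of the linear map `u ↦ ω (u, ·)`. -/
def formRank (ω : E [⋀^Fin 2]→ₗ[ℂ] ℂ) : ℕ := finrank ℂ (LinearMap.range ω.curryLeft)

/-- A subspace is isotropic if the form vanishes on it. -/
def IsIsotropic (ω : E [⋀^Fin 2]→ₗ[ℂ] ℂ) (V : Submodule ℂ E) : Prop :=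
  ∀ u ∈ V, ∀ v ∈ V, ω ![u, v] = 0

/-- The set `F_ω(d_0, …, d_r, E)` of flags of isotropic subspaces. -/
def isotropicFlags (ω : E [⋀^Fin 2]→ₗ[ℂ] ℂ) (d : Fin (r + 1) → ℕ) : Set (Flag d E) :=
  {p | ∀ i, IsIsotropic ω (p.V i)}

/-- The section of `Λ² T*` defined by a skew-form `ω` on `E`, with value the restriction of `ω`
to the largest member of the flag. -/
def formSection (ω : E [⋀^Fin 2]→ₗ[ℂ] ℂ) (q : Flag d E) : q.top [⋀^Fin 2]→ₗ[ℂ] ℂ :=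
  ω.compLinearMap q.top.subtype

end

end OddSymplectic

end

/-! Around each isotropic flag `p` there is an algebraic chart of the flag manifold in which the
isotropic flags form a coordinate subspace, cut out by k(k-1)/2 coordinates, where k = `d (Fin.last
r)`. The statements on regularity, codimension and ideals are read off from it, since the local ring
of a coordinate subspace is a polynomial ring localized at the origin
(`Chart.isLocalization_localRing`).

To find the chart, take a basis adapted to `p` that contains a kernel vector of the form, at index
`z` (`exists_normalBasis`). For l < k with l ≠ z, the l-th coordinate functional kills the kernel
vector, so it is ω(f_l, ·) for some f_l, and the f_l can be made members of the basis beyond index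
k. The top member of a flag near `p` is the graph of a matrix, spanned by vectors t_i = b_i +
(combination of b_j, j ≥ k). Order the indices below k with `z` first. For i before m, ω(t_i, t_m)
is the matrix entry of t_i at f_m plus terms in the non-special entries (`bilin_add_tail`). Hence
the values ω(t_i, t_m) can replace these special entries as coordinates, and isotropy says that they
vanish. Placing `z` first ensures that f_m exists for every pair. The remaining coordinates place
the smaller members inside the top one.

The special coordinates are also contractions of the section of Λ² T* with regular sections t_i, t_m
of T, so they lie in the ideal of the zero scheme, which is therefore the full vanishing ideal.
Closedness is checked on bases, nonemptiness follows by enlarging isotropic subspaces, and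
genericity follows by describing rank through Gram determinants. -/

namespace OddSymplectic

/-! ### Localizing a polynomial ring at the origin -/

section Ring

open MvPolynomial

variable {ι : Type*}

open Classical in
/-- Setting the variables in `s` equal to zero. -/
noncomputable def killVars (s : Set ι) : MvPolynomial ι ℂ →ₐ[ℂ] MvPolynomial ι ℂ :=
  aeval fun j => if j ∈ s then 0 else X j

/-- Modulo the ideal of these variables the substitution is the identity, as one sees on each
variable. Consequently a polynomial killed by the substitution lies in that ideal. -/
lemma sub_killVars_mem (s : Set ι) (P : MvPolynomial ι ℂ) :
    P - killVars s P ∈ Ideal.span (X '' s : Set (MvPolynomial ι ℂ)) := by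
  classical
  rw [← Ideal.Quotient.eq]
  have h : (Ideal.Quotient.mkₐ ℂ (Ideal.span (X '' s : Set (MvPolynomial ι ℂ)))) =
      (Ideal.Quotient.mkₐ ℂ (Ideal.span (X '' s : Set (MvPolynomial ι ℂ)))).comp
        (killVars s) := by
    refine MvPolynomial.algHom_ext fun j => ?_
    by_cases hj : j ∈ s
    · simp only [killVars, AlgHom.comp_apply, aeval_X, if_pos hj, map_zero]
      exact Ideal.Quotient.eq_zero_iff_mem.2 (Ideal.subset_span ⟨j, hj, rfl⟩)
    · simp [killVars, hj]
  exact DFunLike.congr_fun h P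

open Classical in
lemma eval_killVars (s : Set ι) (x : ι → ℂ) (P : MvPolynomial ι ℂ) :
    eval x (killVars s P) = eval (fun j => if j ∈ s then 0 else x j) P := by
  have h : (aeval x).comp (killVars s) =
      (aeval (fun j => if j ∈ s then 0 else x j) : MvPolynomial ι ℂ →ₐ[ℂ] ℂ) := by
    refine MvPolynomial.algHom_ext fun j => ?_
    by_cases hj : j ∈ s <;> simp [killVars, hj]
  exact DFunLike.congr_fun h P

/-- The maximal ideal of the origin. -/
noncomputable abbrev originIdeal (ι : Type*) : Ideal (MvPolynomial ι ℂ) :=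
  RingHom.ker (eval (0 : ι → ℂ))

instance : (originIdeal ι).IsPrime := RingHom.ker_isPrime _

lemma originIdeal_eq_span : originIdeal ι = Ideal.span (Set.range X) := by
  apply le_antisymm
  · intro P hP
    have h := sub_killVars_mem Set.univ P
    rw [Set.image_univ] at h
    have h0 : killVars Set.univ P = 0 := by
      have h1 : killVars (Set.univ : Set ι) = (Algebra.ofId ℂ _).comp (aeval 0) :=
        MvPolynomial.algHom_ext fun j => by simp [killVars]
      rw [h1, AlgHom.comp_apply]
      erw [show aeval (0 : ι → ℂ) P = 0 from hP]
      simp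
    rwa [h0, sub_zero] at h
  · rw [Ideal.span_le]
    rintro _ ⟨j, rfl⟩
    simp [RingHom.mem_ker]

/-- The kernels of `killVars s` for growing `s` are prime, because the target is a domain, and
adding a variable to `s` makes the kernel strictly larger. -/
lemma card_le_height_originIdeal [Finite ι] : (Nat.card ι : ℕ∞) ≤ (originIdeal ι).height := by
  classical
  have := Fintype.ofFinite ι
  have key (s : Finset ι) :
      (s.card : ℕ∞) ≤ (RingHom.ker (killVars (s : Set ι)).toRingHom).height := by
    induction s using Finset.induction_on with
    | empty => simp
    | insert a s ha ih =>
      have hlt : RingHom.ker (killVars (s : Set ι)).toRingHom <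
          RingHom.ker (killVars ((insert a s : Finset ι) : Set ι)).toRingHom := by
        refine lt_of_le_of_ne ?_ fun h => ?_
        · intro P hP
          have hP' : killVars (s : Set ι) P = 0 := hP
          have hc : (killVars ((insert a s : Finset ι) : Set ι)).comp (killVars (s : Set ι)) =
              killVars ((insert a s : Finset ι) : Set ι) := by
            refine MvPolynomial.algHom_ext fun j => ?_
            by_cases hj : j ∈ s <;> simp [killVars, hj]
          have : killVars ((insert a s : Finset ι) : Set ι) P = 0 := by
            rw [← hc, AlgHom.comp_apply, hP', map_zero]
          exact this
        · have h1 : (X a : MvPolynomial ι ℂ) ∈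
              RingHom.ker (killVars ((insert a s : Finset ι) : Set ι)).toRingHom := by
            simp [RingHom.mem_ker, killVars]
          rw [← h] at h1
          simp [RingHom.mem_ker, killVars, ha] at h1
      have := RingHom.ker_isPrime (killVars (s : Set ι)).toRingHom
      have := RingHom.ker_isPrime (killVars ((insert a s : Finset ι) : Set ι)).toRingHom
      have hlt' := Ideal.height_strict_mono_of_isPrime_of_isPrime hlt
      rw [Finset.card_insert_of_notMem ha, Nat.cast_succ]
      generalize (RingHom.ker (killVars (s : Set ι)).toRingHom).height = a at ih hlt'
      exact Order.add_one_le_of_lt (ih.trans_lt hlt')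
  rw [Nat.card_eq_fintype_card]
  refine (key Finset.univ).trans (Ideal.height_mono ?_)
  intro P hP
  have hP' : killVars ((Finset.univ : Finset ι) : Set ι) P = 0 := hP
  have h2 := eval_killVars ((Finset.univ : Finset ι) : Set ι) 0 P
  rw [hP', map_zero] at h2
  simp only [Finset.coe_univ, Set.mem_univ, if_true] at h2
  exact h2.symm

/-- The local ring of an affine space at the origin is regular, of the expected dimension. -/
theorem isRegularLocalRing_of_originIdeal [Finite ι] (A : Type*) [CommRing A]
    [Algebra (MvPolynomial ι ℂ) A] [IsLocalization.AtPrime A (originIdeal ι)] :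
    IsRegularLocalRing A ∧ ringKrullDim A = (Nat.card ι : ℕ) := by
  have hloc := IsLocalization.AtPrime.isLocalRing A (originIdeal ι)
  have hnoeth : IsNoetherianRing A :=
    IsLocalization.isNoetherianRing (originIdeal ι).primeCompl A inferInstance
  have hle : (Nat.card ι : WithBot ℕ∞) ≤ ringKrullDim A := by
    rw [IsLocalization.AtPrime.ringKrullDim_eq_height (originIdeal ι) A]
    exact_mod_cast card_le_height_originIdeal
  -- The variables generate the maximal ideal, so the embedding dimension is at most their number,
  -- which is at most the Krull dimension.
  have hspan : (IsLocalRing.maximalIdeal A).spanFinrank ≤ Nat.card ι := by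
    rw [← IsLocalization.AtPrime.map_eq_maximalIdeal (originIdeal ι) A, originIdeal_eq_span,
      Ideal.map_span, ← Set.range_comp]
    refine (Submodule.spanFinrank_span_le_ncard_of_finite (Set.finite_range _)).trans ?_
    rw [← Set.image_univ]
    exact (Set.ncard_image_le).trans (Set.ncard_univ ι).le
  have hspan' : ((IsLocalRing.maximalIdeal A).spanFinrank : WithBot ℕ∞) ≤ Nat.card ι := by
    exact_mod_cast hspan
  exact ⟨IsRegularLocalRing.of_spanFinrank_maximalIdeal_le A (hspan'.trans hle),
    le_antisymm ((ringKrullDim_le_spanFinrank_maximalIdeal A).trans hspan') hle⟩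

end Ring

/-! ### Regular functions on the flag manifold -/

section Regular

lemma const_mem_polyFun {W : Type*} [AddCommGroup W] [Module ℂ W] (c : ℂ) :
    (fun _ : W => c) ∈ polyFun W :=
  (polyFun W).algebraMap_mem c

lemma dual_mem_polyFun {W : Type*} [AddCommGroup W] [Module ℂ W] (l : Dual ℂ W) :
    (l : W → ℂ) ∈ polyFun W :=
  Algebra.subset_adjoin ⟨l, rfl⟩

lemma isOpen_ne_zero {W : Type*} [AddCommGroup W] [Module ℂ W] {P : W → ℂ} (hP : P ∈ polyFun W) :
    IsOpen[zariskiTopology W] {w | P w ≠ 0} :=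
  TopologicalSpace.isOpen_generateFrom_of_mem ⟨P, hP, rfl⟩

/-- Products of polynomial functions show that the generating sets are stable under finite
intersection, hence form a basis of the topology. -/
lemma exists_polyFun_of_isOpen {W : Type*} [AddCommGroup W] [Module ℂ W] {U : Set W}
    (hU : IsOpen[zariskiTopology W] U) {x : W} (hx : x ∈ U) :
    ∃ P ∈ polyFun W, P x ≠ 0 ∧ ∀ y, P y ≠ 0 → y ∈ U := by
  induction hU with
  | basic s hs =>
    obtain ⟨P, hP, rfl⟩ := hs
    exact ⟨P, hP, hx, fun y hy => hy⟩
  | univ => exact ⟨1, one_mem _, by simp, fun _ _ => trivial⟩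
  | inter s t _ _ h1 h2 =>
    obtain ⟨P, hP, hPx, h1⟩ := h1 hx.1
    obtain ⟨Q, hQ, hQx, h2⟩ := h2 hx.2
    exact ⟨P * Q, mul_mem hP hQ, mul_ne_zero hPx hQx, fun y hy =>
      ⟨h1 y (left_ne_zero_of_mul hy), h2 y (right_ne_zero_of_mul hy)⟩⟩
  | sUnion s _ h =>
    obtain ⟨t, ht, hxt⟩ := hx
    obtain ⟨P, hP, hPx, h1⟩ := h t ht hxt
    exact ⟨P, hP, hPx, fun y hy => ⟨t, ht, h1 y hy⟩⟩

variable {r : ℕ} {d : Fin (r + 1) → ℕ} {E : Type*} [AddCommGroup E] [Module ℂ E]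

lemma exists_polyFun_of_isOpen_flag {U : Set (Flag d E)} (hU : IsOpen U) {x : AdaptedBasis d E}
    (hx : x.flag ∈ U) : ∃ P ∈ polyFun (Fin (finrank ℂ E) → E), P x.vec ≠ 0 ∧
      ∀ y : AdaptedBasis d E, P y.vec ≠ 0 → y.flag ∈ U := by
  rw [isOpen_coinduced] at hU
  obtain ⟨V, hV, hVU⟩ := (@isOpen_induced_iff _ _ (zariskiTopology _) _ _).1 hU
  have hxV : x ∈ AdaptedBasis.vec ⁻¹' V := by rw [hVU]; exact hx
  obtain ⟨P, hP, hPx, h⟩ := exists_polyFun_of_isOpen hV hxV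
  refine ⟨P, hP, hPx, fun y hy => ?_⟩
  have : y ∈ AdaptedBasis.vec ⁻¹' V := h _ hy
  rwa [hVU] at this

/-- In the quotient topology openness is tested on bases, so the polynomials used need not be
invariant under change of adapted basis. -/
lemma isOpen_flag_of_exists_polyFun {U : Set (Flag d E)}
    (h : ∀ x : AdaptedBasis d E, x.flag ∈ U → ∃ P ∈ polyFun (Fin (finrank ℂ E) → E),
      P x.vec ≠ 0 ∧ ∀ y : AdaptedBasis d E, P y.vec ≠ 0 → y.flag ∈ U) : IsOpen U := by
  rw [isOpen_coinduced, isOpen_iff_forall_mem_open]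
  intro x hx
  obtain ⟨P, hP, hPx, h1⟩ := h x hx
  exact ⟨AdaptedBasis.vec ⁻¹' {w | P w ≠ 0}, h1,
    (@isOpen_induced_iff _ _ (zariskiTopology _) _ _).2 ⟨_, isOpen_ne_zero hP, rfl⟩, hPx⟩

variable {p : Flag d E}

lemma const_mem_regularAt (c : ℂ) : (fun _ => c) ∈ regularAt p :=
  ⟨Set.univ, isOpen_univ, trivial, fun _ _ => ⟨fun _ => c, const_mem_polyFun c, 1, one_mem _,
    by simp, fun _ _ _ => by simp⟩⟩

lemma inv_mem_regularAt_and_eventually_ne {f : Flag d E → ℂ} (hf : f ∈ regularAt p)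
    (hfp : f p ≠ 0) : f⁻¹ ∈ regularAt p ∧ ∀ᶠ q in 𝓝 p, f q ≠ 0 := by
  obtain ⟨U, hU, hpU, hf⟩ := hf
  have hopen : IsOpen {q | q ∈ U ∧ f q ≠ 0} := by
    refine isOpen_flag_of_exists_polyFun fun x ⟨hxU, hx⟩ => ?_
    obtain ⟨P, hP, Q, hQ, hQx, h1⟩ := hf x hxU
    obtain ⟨R, hR, hRx, h2⟩ := exists_polyFun_of_isOpen_flag hU hxU
    refine ⟨P * Q * R, mul_mem (mul_mem hP hQ) hR, mul_ne_zero (mul_ne_zero ?_ hQx) hRx, ?_⟩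
    · rw [h1 x hxU hQx] at hx
      exact (div_ne_zero_iff.1 hx).1
    · intro y hy
      obtain ⟨h3, h4⟩ := mul_ne_zero_iff.1 hy
      obtain ⟨h5, h6⟩ := mul_ne_zero_iff.1 h3
      refine ⟨h2 y h4, ?_⟩
      rw [h1 y (h2 y h4) h6]
      exact div_ne_zero h5 h6
  refine ⟨⟨_, hopen, ⟨hpU, hfp⟩, fun x ⟨hxU, hx⟩ => ?_⟩, ?_⟩
  · obtain ⟨P, hP, Q, hQ, hQx, h1⟩ := hf x hxU
    rw [h1 x hxU hQx] at hx
    -- The inverse is written Q²/(PQ) instead of Q/P, so that a nonzero denominator forces Q ≠ 0,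
    -- where the formula for `f` is valid.
    refine ⟨Q * Q, mul_mem hQ hQ, P * Q, mul_mem hP hQ,
      mul_ne_zero (div_ne_zero_iff.1 hx).1 hQx, fun y hy hne => ?_⟩
    obtain ⟨h5, h6⟩ := mul_ne_zero_iff.1 hne
    rw [Pi.inv_apply, h1 y hy.1 h6, inv_div]
    simp only [Pi.mul_apply]
    field_simp
  · exact (hopen.eventually_mem ⟨hpU, hfp⟩).mono fun q hq => hq.2

lemma eval_mem_regularAt {κ : Type*} {c : κ → Flag d E → ℂ} (hc : ∀ i, c i ∈ regularAt p)
    (G : MvPolynomial κ ℂ) : (fun q => MvPolynomial.eval (fun i => c i q) G) ∈ regularAt p := by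
  induction G using MvPolynomial.induction_on with
  | C a => simpa using const_mem_regularAt a
  | add P Q hP hQ => simpa using! add_mem hP hQ
  | mul_X P i hP => simpa using! mul_mem hP (hc i)

end Regular

/-! ### Charts of the flag manifold -/

section Chart

variable {r : ℕ} {d : Fin (r + 1) → ℕ} {E : Type*} [AddCommGroup E] [Module ℂ E]

/-- A chart of the flag manifold centred at `p`: an affine space that is mapped polynomially to the
bases of `E`, such that the composite with the quotient map to the flags is a local isomorphism. -/
structure Chart (p : Flag d E) (ι : Type*) where
  /-- the basis attached to a point of the affine space -/
  lift : (ι → ℂ) → AdaptedBasis d E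
  /-- the coordinates of a flag -/
  coord : Flag d E → ι → ℂ
  lift_poly : ∀ P ∈ polyFun (Fin (finrank ℂ E) → E), ∃ P' : MvPolynomial ι ℂ,
    ∀ x, P (lift x).vec = MvPolynomial.eval x P'
  coord_regular : ∀ i, (fun q => coord q i) ∈ regularAt p
  coord_lift : ∀ x, coord (lift x).flag = x
  lift_coord : ∀ᶠ q in 𝓝 p, (lift (coord q)).flag = q
  coord_self : coord p = 0

namespace Chart

open MvPolynomial

variable {p : Flag d E} {ι : Type*} (φ : Chart p ι)

lemma lift_zero : (φ.lift 0).flag = p := by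
  simpa [φ.coord_self] using φ.lift_coord.self_of_nhds

/-- The single fraction that represents `f` around the basis `lift 0` suffices: composing it with
the polynomial map `lift` gives a fraction in the coordinates. -/
lemma exists_frac {f : Flag d E → ℂ} (hf : f ∈ regularAt p) : ∃ P Q : MvPolynomial ι ℂ,
    eval 0 Q ≠ 0 ∧ ∀ᶠ q in 𝓝 p, f q * eval (φ.coord q) Q = eval (φ.coord q) P := by
  obtain ⟨U, hU, hpU, hf⟩ := hf
  obtain ⟨P, hP, Q, hQ, hQ0, h⟩ := hf (φ.lift 0) (by rwa [φ.lift_zero])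
  obtain ⟨P', hP'⟩ := φ.lift_poly P hP
  obtain ⟨Q', hQ'⟩ := φ.lift_poly Q hQ
  rw [hQ'] at hQ0
  refine ⟨P', Q', hQ0, ?_⟩
  have hne := (inv_mem_regularAt_and_eventually_ne (eval_mem_regularAt φ.coord_regular Q')
    (by simpa [φ.coord_self] using! hQ0)).2
  filter_upwards [φ.lift_coord, hU.eventually_mem hpU, hne] with q h1 h2 h3
  have h4 := h (φ.lift (φ.coord q)) (by rwa [h1]) (by rw [hQ']; exact h3)
  rw [h1, hP', hQ'] at h4
  rw [h4, div_mul_cancel₀ _ h3]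

variable (S : Set ι)

open Classical in
/-- Restriction of polynomials to the coordinate subspace where the coordinates in `S` vanish. -/
noncomputable def restr (S : Set ι) : MvPolynomial ι ℂ →ₐ[ℂ] MvPolynomial {i // i ∉ S} ℂ :=
  aeval fun j => if h : j ∉ S then X ⟨j, h⟩ else 0

open Classical in
lemma eval_restr (y : {i // i ∉ S} → ℂ) (P : MvPolynomial ι ℂ) :
    eval y (restr S P) = eval (fun j => if h : j ∉ S then y ⟨j, h⟩ else 0) P := by
  have h : (aeval y).comp (restr S) =
      (aeval (fun j => if h : j ∉ S then y ⟨j, h⟩ else 0) : MvPolynomial ι ℂ →ₐ[ℂ] ℂ) := by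
    refine MvPolynomial.algHom_ext fun j => ?_
    by_cases hj : j ∈ S <;> simp [restr, hj]
  exact DFunLike.congr_fun h P

lemma eval_restr_of_vanish {x : ι → ℂ} (hx : ∀ i ∈ S, x i = 0) (P : MvPolynomial ι ℂ) :
    eval (fun i : {i // i ∉ S} => x i) (restr S P) = eval x P := by
  classical
  rw [eval_restr]
  congr 2
  funext j
  by_cases hj : j ∈ S <;> simp [hj, hx]

variable {S} {Z : Set (Flag d E)}

/-- `G` vanishes where some polynomial `H` with `H(0) ≠ 0` does not vanish on the coordinate
subspace. So `G * restr S H` is zero as a function, hence as a polynomial, and `restr S H ≠ 0`. -/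
lemma eq_zero_of_eventually (hZ : ∀ᶠ q in 𝓝 p, q ∈ Z ↔ ∀ i ∈ S, φ.coord q i = 0)
    {G : MvPolynomial {i // i ∉ S} ℂ}
    (hG : ∀ᶠ q in 𝓝[Z] p, eval (fun i : {i // i ∉ S} => φ.coord q i) G = 0) : G = 0 := by
  classical
  obtain ⟨U, hU, hUo, hpU⟩ := eventually_nhds_iff.1 (hZ.and (eventually_nhdsWithin_iff.1 hG))
  obtain ⟨P, hP, hP0, h⟩ := exists_polyFun_of_isOpen_flag hUo
    (x := φ.lift 0) (by rwa [φ.lift_zero])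
  obtain ⟨H, hH⟩ := φ.lift_poly P hP
  have hprod : G * restr S H = 0 := by
    refine MvPolynomial.funext fun y => ?_
    rw [map_mul, map_zero, eval_restr]
    by_cases h0 : eval (fun j => if h : j ∉ S then y ⟨j, h⟩ else 0) H = 0
    · rw [h0, mul_zero]
    · rw [← hH] at h0
      obtain ⟨h1, h2⟩ := hU _ (h _ h0)
      rw [φ.coord_lift] at h1 h2
      have h3 := h2 (h1.2 fun i hi => by simp [hi])
      have h4 : (fun i : {i // i ∉ S} => (if h : (i : ι) ∉ S then y ⟨i, h⟩ else 0)) = y := by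
        funext i
        simp [i.2]
      rw [h4] at h3
      rw [h3, zero_mul]
  refine (mul_eq_zero.1 hprod).resolve_right fun h0 => hP0 ?_
  have h1 := eval_restr_of_vanish S (x := 0) (fun _ _ => rfl) H
  rw [h0, map_zero] at h1
  rw [hH, ← h1]

variable (Z) in
/-- Polynomials in the coordinates outside `S`, as elements of the local ring of `Z`. -/
noncomputable def toLocalRing (S : Set ι) : MvPolynomial {i // i ∉ S} ℂ →+* localRing Z p :=
  ((Germ.coeRingHom (𝓝[Z] p)).comp
    (RingHom.pi fun q => eval fun i : {i // i ∉ S} => φ.coord q i)).codRestrict (localRing Z p)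
    fun G => ⟨_, eval_mem_regularAt (fun i : {i // i ∉ S} => φ.coord_regular i) G, rfl⟩

/-- The local ring of a subset of the flag manifold that is a coordinate subspace in some chart. -/
theorem isLocalization_localRing (hZ : ∀ᶠ q in 𝓝 p, q ∈ Z ↔ ∀ i ∈ S, φ.coord q i = 0) :
    letI := (φ.toLocalRing Z S).toAlgebra
    IsLocalization.AtPrime (localRing Z p) (originIdeal {i // i ∉ S}) := by
  let := (φ.toLocalRing Z S).toAlgebra
  refine ⟨?_, ?_, ?_⟩
  · rintro ⟨G, hG⟩
    have hG0 : eval (0 : {i // i ∉ S} → ℂ) G ≠ 0 := hG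
    have hreg := eval_mem_regularAt (fun i : {i // i ∉ S} => φ.coord_regular i) G
    obtain ⟨h1, h2⟩ := inv_mem_regularAt_and_eventually_ne hreg
      (by simpa [φ.coord_self] using! hG0)
    refine IsUnit.of_mul_eq_one ⟨_, _, h1, rfl⟩ (Subtype.ext ?_)
    refine Germ.coe_eq.2 ?_
    filter_upwards [h2.filter_mono nhdsWithin_le_nhds] with q hq
    exact mul_inv_cancel₀ hq
  · rintro ⟨_, f, hf, rfl⟩
    obtain ⟨P, Q, hQ, h⟩ := φ.exists_frac hf
    refine ⟨⟨restr S P, ⟨restr S Q, ?_⟩⟩, Subtype.ext (Germ.coe_eq.2 ?_)⟩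
    · have h1 := eval_restr_of_vanish S (x := 0) (fun _ _ => rfl) Q
      intro h2
      exact hQ (h1 ▸ h2)
    · filter_upwards [h.filter_mono nhdsWithin_le_nhds, hZ.filter_mono nhdsWithin_le_nhds,
        self_mem_nhdsWithin] with q h1 h2 h3
      have h4 := h2.1 h3
      change f q * eval (fun i : {i // i ∉ S} => φ.coord q i) (restr S Q) =
        eval (fun i : {i // i ∉ S} => φ.coord q i) (restr S P)
      rw [eval_restr_of_vanish S h4, eval_restr_of_vanish S h4, h1]
  · intro G H hGH
    refine ⟨1, ?_⟩
    have h1 : φ.toLocalRing Z S G = φ.toLocalRing Z S H := hGH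
    have h2 := Germ.coe_eq.1 (congrArg Subtype.val h1)
    have h3 : G - H = 0 := φ.eq_zero_of_eventually hZ (h2.mono fun q hq => by
      rw [map_sub, sub_eq_zero]; exact hq)
    rw [sub_eq_zero.1 h3]

theorem isRegularLocalRing_localRing [Finite ι]
    (hZ : ∀ᶠ q in 𝓝 p, q ∈ Z ↔ ∀ i ∈ S, φ.coord q i = 0) :
    IsRegularLocalRing (localRing Z p) ∧
      ringKrullDim (localRing Z p) = (Nat.card {i // i ∉ S} : ℕ) := by
  let := (φ.toLocalRing Z S).toAlgebra
  have := φ.isLocalization_localRing hZ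
  exact isRegularLocalRing_of_originIdeal (ι := {i // i ∉ S}) (localRing Z p)

/-- The smoothness of a coordinate subspace, and its codimension. -/
theorem isRegularLocalRing_and_ringKrullDim_add [Finite ι]
    (hZ : ∀ᶠ q in 𝓝 p, q ∈ Z ↔ ∀ i ∈ S, φ.coord q i = 0) :
    IsRegularLocalRing (localRing Z p) ∧
      ringKrullDim (localRing Z p) + (S.ncard : ℕ) =
        ringKrullDim (localRing (Set.univ : Set (Flag d E)) p) := by
  obtain ⟨h1, h2⟩ := φ.isRegularLocalRing_localRing hZ
  -- The flag manifold itself is the case in which no coordinate is required to vanish.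
  obtain ⟨-, h3⟩ := φ.isRegularLocalRing_localRing (Z := Set.univ) (S := ∅) (by simp)
  refine ⟨h1, ?_⟩
  rw [h2, h3, ← Nat.cast_add, add_comm]
  have h4 : Nat.card {i // i ∉ S} = Sᶜ.ncard := rfl
  have h5 : Nat.card {i // i ∉ (∅ : Set ι)} = Nat.card ι := by
    simp
  rw [h4, h5, Set.ncard_add_ncard_compl]

/-- The ideal of a coordinate subspace is generated by the coordinates that vanish on it. -/
theorem vanishingIdeal_le (hZ : ∀ᶠ q in 𝓝 p, q ∈ Z ↔ ∀ i ∈ S, φ.coord q i = 0)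
    (I : Ideal (localRing (Set.univ : Set (Flag d E)) p))
    (hI : ∀ i ∈ S, ∀ g : localRing (Set.univ : Set (Flag d E)) p,
      (g : Germ (𝓝[Set.univ] p) ℂ) = ((fun q => φ.coord q i : Flag d E → ℂ) :
        Germ (𝓝[Set.univ] p) ℂ) → g ∈ I) :
    vanishingIdeal Z p ≤ I := by
  rintro ⟨_, hg⟩ ⟨f, hf, rfl, hf0⟩
  obtain ⟨P, Q, hQ, h⟩ := φ.exists_frac hf
  -- Since `f` is P/Q with Q a unit at `p`, it suffices to treat P, which vanishes on the coordinate
  -- subspace and so lies in the ideal of the variables in `S`.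
  have hP : restr S P = 0 := by
    refine φ.eq_zero_of_eventually hZ ?_
    filter_upwards [h.filter_mono nhdsWithin_le_nhds, hZ.filter_mono nhdsWithin_le_nhds,
        self_mem_nhdsWithin, hf0] with q h1 h2 h3 h4
    rw [eval_restr_of_vanish S (h2.1 h3), ← h1, h4, zero_mul]
  have hkill : killVars S P = 0 := by
    classical
    refine MvPolynomial.funext fun x => ?_
    rw [eval_killVars, ← eval_restr_of_vanish S _ P, hP, map_zero, map_zero]
    intro i hi
    simp [hi]
  have hmem := sub_killVars_mem S P
  rw [hkill, sub_zero] at hmem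
  let θ : MvPolynomial ι ℂ →+* localRing (Set.univ : Set (Flag d E)) p :=
    ((Germ.coeRingHom (𝓝[Set.univ] p)).comp
      (RingHom.pi fun q => eval (φ.coord q))).codRestrict (localRing Set.univ p)
      fun G => ⟨_, eval_mem_regularAt φ.coord_regular G, rfl⟩
  have hθ : Ideal.span (X '' S : Set (MvPolynomial ι ℂ)) ≤ I.comap θ := by
    rw [Ideal.span_le]
    rintro _ ⟨i, hi, rfl⟩
    refine hI i hi (θ (X i)) ?_
    change ((fun q => eval (φ.coord q) (X i) : Flag d E → ℂ) : Germ (𝓝[Set.univ] p) ℂ) = _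
    simp
  have hPI : θ P ∈ I := hθ hmem
  obtain ⟨h1, h2⟩ := inv_mem_regularAt_and_eventually_ne
    (eval_mem_regularAt φ.coord_regular Q) (by simpa [φ.coord_self] using! hQ)
  convert! I.mul_mem_left ⟨_, _, h1, rfl⟩ hPI using 1
  refine Subtype.ext (Germ.coe_eq.2 ?_)
  filter_upwards [h2.filter_mono nhdsWithin_le_nhds, h.filter_mono nhdsWithin_le_nhds] with q h3 h4
  change f q = (eval (φ.coord q) Q)⁻¹ * eval (φ.coord q) P
  rw [← h4]
  have h5 : eval (φ.coord q) Q ≠ 0 := h3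
  field_simp

end Chart

end Chart

/-! ### Bases adapted to a flag -/

section Adapted

variable {E : Type*} [AddCommGroup E] [Module ℂ E]

/-- A spanning sequence of minimal length of a subspace can be extended to one of a larger
subspace. -/
lemma exists_span_image_extend [FiniteDimensional ℂ E] {W W' : Submodule ℂ E} (h : W ≤ W')
    (v : ℕ → E) (hv : W = Submodule.span ℂ (v '' {j | j < finrank ℂ W})) :
    ∃ v' : ℕ → E, (∀ j < finrank ℂ W, v' j = v j) ∧
      W' = Submodule.span ℂ (v' '' {j | j < finrank ℂ W'}) := by
  obtain ⟨C, hC⟩ := Submodule.exists_isCompl W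
  -- By the modular law, `C ⊓ W'` is a complement of `W` inside `W'`.
  have hsup : W ⊔ (C ⊓ W') = W' := by
    rw [← sup_inf_assoc_of_le C h, hC.sup_eq_top, top_inf_eq]
  have hinf : W ⊓ (C ⊓ W') = ⊥ := by
    rw [← inf_assoc, hC.inf_eq_bot, bot_inf_eq]
  have hdim : finrank ℂ W + finrank ℂ (C ⊓ W' : Submodule ℂ E) = finrank ℂ W' := by
    have := Submodule.finrank_sup_add_finrank_inf_eq W (C ⊓ W')
    rw [hsup, hinf, finrank_bot] at this
    omega
  let c := finBasis ℂ (C ⊓ W' : Submodule ℂ E)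
  let v' : ℕ → E := fun j => if j < finrank ℂ W then v j else
    if hj : j - finrank ℂ W < finrank ℂ (C ⊓ W' : Submodule ℂ E) then c ⟨_, hj⟩ else 0
  refine ⟨v', fun j hj => if_pos hj, ?_⟩
  have hset : v' '' {j | j < finrank ℂ W'} = v '' {j | j < finrank ℂ W} ∪
      Set.range fun i => (c i : E) := by
    ext y
    constructor
    · rintro ⟨j, hj, rfl⟩
      by_cases h1 : j < finrank ℂ W
      · exact Or.inl ⟨j, h1, (if_pos h1).symm⟩
      · have h2 : j - finrank ℂ W < finrank ℂ (C ⊓ W' : Submodule ℂ E) := by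
          have : j < finrank ℂ W' := hj
          omega
        exact Or.inr ⟨⟨_, h2⟩, by simp [v', h1, h2]⟩
    · rintro (⟨j, hj, rfl⟩ | ⟨i, rfl⟩)
      · have h1 : j < finrank ℂ W := hj
        exact ⟨j, show j < _ by omega, if_pos hj⟩
      · have := i.2
        exact ⟨finrank ℂ W + i, show finrank ℂ W + (i : ℕ) < finrank ℂ W' by omega, by simp [v']⟩
  rw [hset, Submodule.span_union, ← hv]
  have h3 : Submodule.span ℂ (Set.range fun i => (c i : E)) = C ⊓ W' := by
    have : (Set.range fun i => (c i : E)) = (C ⊓ W').subtype '' Set.range c := by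
      rw [← Set.range_comp]; rfl
    rw [this, Submodule.span_image, c.span_eq, Submodule.map_top, Submodule.range_subtype]
  rw [h3, hsup]

lemma exists_span_image_of_monotone [FiniteDimensional ℂ E] {W : ℕ → Submodule ℂ E}
    (hW : Monotone W) (hW0 : W 0 = ⊥) (m : ℕ) :
    ∃ v : ℕ → E, ∀ a ≤ m, W a = Submodule.span ℂ (v '' {j | j < finrank ℂ (W a)}) := by
  induction m with
  | zero =>
    refine ⟨0, fun a ha => ?_⟩
    rw [Nat.le_zero.1 ha, hW0]
    simp
  | succ m ih =>
    obtain ⟨v, hv⟩ := ih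
    obtain ⟨v', h1, h2⟩ := exists_span_image_extend (hW m.le_succ) v (hv m le_rfl)
    refine ⟨v', fun a ha => ?_⟩
    rcases Nat.lt_or_ge m a with h | h
    · obtain rfl : a = m + 1 := by omega
      exact h2
    · refine (hv a h).trans (congrArg _ (Set.image_congr fun j hj => (h1 j ?_).symm))
      have hj' : j < finrank ℂ (W a) := hj
      exact hj'.trans_le (Submodule.finrank_mono (hW h))

lemma exists_basis_eq_of_span [FiniteDimensional ℂ E] (v : Fin (finrank ℂ E) → E)
    (hv : ⊤ ≤ Submodule.span ℂ (Set.range v)) :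
    ∃ b : Basis (Fin (finrank ℂ E)) ℂ E, ⇑b = v :=
  ⟨basisOfTopLeSpanOfCardEqFinrank v hv (by simp),
    coe_basisOfTopLeSpanOfCardEqFinrank v hv (by simp)⟩

variable {r : ℕ} {d : Fin (r + 1) → ℕ}

/-- Every flag is spanned by parts of a basis. -/
theorem exists_adaptedBasis [FiniteDimensional ℂ E] (p : Flag d E) :
    ∃ x : AdaptedBasis d E, x.flag = p := by
  -- The flag is padded with ⊥ at index 0 and ⊤ from `r + 2` on, so that the chain yields a basis of
  -- the whole space; the `i`-th member sits at index `i + 1`.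
  let W : ℕ → Submodule ℂ E := fun a =>
    if a = 0 then ⊥ else if h : a - 1 < r + 1 then p.V ⟨a - 1, h⟩ else ⊤
  have hW : Monotone W := by
    intro a a' haa
    by_cases h0 : a = 0
    · simp [W, h0]
    by_cases h1 : a' - 1 < r + 1
    · have h2 : a - 1 < r + 1 := by omega
      have h3 : a' ≠ 0 := by omega
      simp only [W, h0, h3, if_false, h1, h2, dif_pos]
      exact p.mono (Fin.mk_le_mk.2 (by omega))
    · have h3 : a' ≠ 0 := by omega
      simp only [W, h3, if_false, h1, dif_neg, not_false_eq_true]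
      exact le_top
  obtain ⟨v, hv⟩ := exists_span_image_of_monotone hW (by simp [W]) (r + 2)
  have htop := hv (r + 2) le_rfl
  have hWtop : W (r + 2) = ⊤ := by simp [W]
  rw [hWtop, finrank_top] at htop
  obtain ⟨b, hb⟩ := exists_basis_eq_of_span (fun j : Fin (finrank ℂ E) => v j) (by
    rw [htop]
    refine Submodule.span_mono ?_
    rintro _ ⟨j, hj, rfl⟩
    exact ⟨⟨j, hj⟩, rfl⟩)
  refine ⟨⟨b, p, fun i => ?_⟩, rfl⟩
  have h1 := hv (i + 1) (by omega)
  have hWi : W (i + 1) = p.V i := by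
    have := i.2
    simp [W, show (i : ℕ) ≤ r by omega]
  rw [hWi, p.finrank_eq] at h1
  rw [h1, hb]
  congr 1
  ext y
  have hle : d i ≤ finrank ℂ E := p.finrank_eq i ▸ Submodule.finrank_le _
  constructor
  · rintro ⟨j, hj, rfl⟩
    exact ⟨⟨j, lt_of_lt_of_le hj hle⟩, hj, rfl⟩
  · rintro ⟨j, hj, rfl⟩
    exact ⟨j, hj, rfl⟩

lemma card_fin_lt {N m : ℕ} (hm : m ≤ N) : Fintype.card {l : Fin N // (l : ℕ) < m} = m := by
  rw [Fintype.card_subtype]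
  have h2 : (Finset.univ.filter fun j : Fin N => (j : ℕ) < m) =
      Finset.univ.map (Fin.castLEEmb hm) := by
    ext j
    simp only [Finset.mem_filter, Finset.mem_univ, true_and, Finset.mem_map]
    constructor
    · intro h
      exact ⟨⟨j, h⟩, rfl⟩
    · rintro ⟨i, rfl⟩
      exact i.2
  rw [h2, Finset.card_map, Finset.card_univ, Fintype.card_fin]

lemma finrank_span_basis_lt (b : Basis (Fin (finrank ℂ E)) ℂ E) {m : ℕ}
    (hm : m ≤ finrank ℂ E) : finrank ℂ (Submodule.span ℂ (b '' {j | (j : ℕ) < m})) = m := by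
  have h1 : b '' {j | (j : ℕ) < m} = Set.range fun j : {j : Fin (finrank ℂ E) // (j : ℕ) < m} =>
      b j := by
    ext y; simp
  have h3 := finrank_span_eq_card (b.linearIndependent.comp
    (Subtype.val : {j : Fin (finrank ℂ E) // (j : ℕ) < m} → _) Subtype.val_injective)
  rw [h1]
  exact h3.trans (card_fin_lt hm)

/-- The flag spanned by parts of a given basis. -/
def AdaptedBasis.ofBasis (hd : Monotone d) (hdE : ∀ i, d i ≤ finrank ℂ E)
    (b : Basis (Fin (finrank ℂ E)) ℂ E) : AdaptedBasis d E where
  basis := b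
  flag :=
    { V := fun i => Submodule.span ℂ (b '' {j | (j : ℕ) < d i})
      mono := fun _ _ hij => Submodule.span_mono
        (Set.image_mono fun _ hj => lt_of_lt_of_le hj (hd hij))
      finrank_eq := fun i => finrank_span_basis_lt b (hdE i) }
  adapted := fun _ => rfl

/-- An adapted basis can be modified to contain a given non-zero vector. -/
theorem exists_adaptedBasis_apply_eq [FiniteDimensional ℂ E] (p : Flag d E) {κ : E} (hκ : κ ≠ 0) :
    ∃ x : AdaptedBasis d E, x.flag = p ∧ ∃ z, x.basis z = κ := by
  obtain ⟨x, rfl⟩ := exists_adaptedBasis p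
  let b := x.basis
  -- Let `z` be the last index with a nonzero coordinate of `κ`, and exchange `b z` for `κ`. Initial
  -- spans reaching past `z` already contain `κ`, and the others do not involve `b z`, so the flag
  -- is unchanged.
  have hne : (Finset.univ.filter fun j => b.repr κ j ≠ 0).Nonempty := by
    by_contra h
    rw [Finset.not_nonempty_iff_eq_empty, Finset.filter_eq_empty_iff] at h
    refine hκ (b.ext_elem fun j => ?_)
    simpa using h (Finset.mem_univ j)
  obtain ⟨z, hz, hmax⟩ := Finset.exists_max_image _ id hne
  have hz0 : b.repr κ z ≠ 0 := (Finset.mem_filter.1 hz).2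
  have hsum : κ = ∑ j, b.repr κ j • b j := (b.sum_repr κ).symm
  have hout (j : Fin (finrank ℂ E)) (hj : z < j) : b.repr κ j = 0 := by
    by_contra h
    exact absurd (hmax j (by simp [h])) (not_le.2 hj)
  have hin (m : ℕ) (hzm : (z : ℕ) < m) : Submodule.span ℂ (b '' {j | (j : ℕ) < m}) ≤
      Submodule.span ℂ (Function.update b z κ '' {j | (j : ℕ) < m}) := by
    have hmem (j : Fin (finrank ℂ E)) (hj : (j : ℕ) < m) (hjz : j ≠ z) :
        b j ∈ Submodule.span ℂ (Function.update b z κ '' {j | (j : ℕ) < m}) :=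
      Submodule.subset_span ⟨j, hj, by simp [hjz]⟩
    rw [Submodule.span_le]
    rintro _ ⟨j, hj, rfl⟩
    by_cases hjz : j = z
    · subst hjz
      have h1 : b.repr κ j • b j = κ - ∑ i ∈ Finset.univ.erase j, b.repr κ i • b i := by
        rw [eq_sub_iff_add_eq,
          Finset.add_sum_erase _ (fun i => b.repr κ i • b i) (Finset.mem_univ j), ← hsum]
      have h2 : b.repr κ j • b j ∈
          Submodule.span ℂ (Function.update b j κ '' {j | (j : ℕ) < m}) := by
        rw [h1]
        refine sub_mem (Submodule.subset_span ⟨j, hj, by simp⟩) (sum_mem fun i hi => ?_)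
        rcases lt_or_ge j i with h | h
        · rw [hout i h, zero_smul]
          exact zero_mem _
        · exact Submodule.smul_mem _ _
            (hmem i (lt_of_le_of_lt h hj) (Finset.ne_of_mem_erase hi))
      exact (Submodule.smul_mem_iff _ hz0).1 h2
    · exact hmem j hj hjz
  obtain ⟨b', hb'⟩ := exists_basis_eq_of_span (Function.update b z κ) (by
    have := hin (finrank ℂ E) z.2
    have h1 : {j : Fin (finrank ℂ E) | (j : ℕ) < finrank ℂ E} = Set.univ := by ext j; simp
    rw [h1, Set.image_univ, Set.image_univ, b.span_eq] at this
    exact this)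
  refine ⟨⟨b', x.flag, fun i => ?_⟩, rfl, z, by rw [hb']; simp⟩
  have hdi : d i ≤ finrank ℂ E := x.flag.finrank_eq i ▸ Submodule.finrank_le _
  rw [x.adapted, hb']
  by_cases hzi : (z : ℕ) < d i
  · refine Submodule.eq_of_le_of_finrank_eq (hin _ hzi) ?_
    rw [finrank_span_basis_lt _ hdi, ← hb', finrank_span_basis_lt _ hdi]
  · congr 1
    refine Set.image_congr fun j hj => ?_
    have : j ≠ z := fun h => hzi (h ▸ hj)
    simp [this, b]

end Adapted

/-! ### Skew-forms -/

section Form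

variable {E : Type*} [AddCommGroup E] [Module ℂ E]

lemma update_vecPair_zero {E : Type*} (u v w : E) : Function.update ![u, v] 0 w = ![w, v] := by
  ext i; fin_cases i <;> rfl

lemma update_vecPair_one {E : Type*} (u v w : E) : Function.update ![u, v] 1 w = ![u, w] := by
  ext i; fin_cases i <;> rfl

/-- A skew-form as a bilinear map. -/
def bilin (ω : E [⋀^Fin 2]→ₗ[ℂ] ℂ) : E →ₗ[ℂ] E →ₗ[ℂ] ℂ :=
  LinearMap.mk₂ ℂ (fun u v => ω ![u, v])
    (fun u u' v => by simpa only [update_vecPair_zero] using ω.map_update_add ![u, v] 0 u u')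
    (fun c u v => by simpa only [update_vecPair_zero] using ω.map_update_smul ![u, v] 0 c u)
    (fun u v v' => by simpa only [update_vecPair_one] using ω.map_update_add ![u, v] 1 v v')
    (fun c u v => by simpa only [update_vecPair_one] using ω.map_update_smul ![u, v] 1 c v)

variable (ω : E [⋀^Fin 2]→ₗ[ℂ] ℂ)

lemma bilin_apply (u v : E) : bilin ω u v = ω ![u, v] := rfl

lemma bilin_self (u : E) : bilin ω u u = 0 :=
  ω.map_eq_zero_of_eq ![u, u] (i := 0) (j := 1) rfl (by simp)

lemma bilin_swap (u v : E) : bilin ω u v = -bilin ω v u := by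
  have h := bilin_self ω (u + v)
  simp only [map_add, LinearMap.add_apply, bilin_self, zero_add, add_zero] at h
  exact eq_neg_of_add_eq_zero_right h

lemma ker_curryLeft : LinearMap.ker ω.curryLeft = LinearMap.ker (bilin ω) := by
  ext u
  simp only [LinearMap.mem_ker]
  constructor
  · intro h
    ext v
    exact congrArg (fun g : E [⋀^Fin 1]→ₗ[ℂ] ℂ => g ![v]) h
  · intro h
    ext v
    have h1 : v = ![v 0] := by ext i; fin_cases i; rfl
    rw [h1]
    exact LinearMap.congr_fun h (v 0)

lemma formRank_eq [FiniteDimensional ℂ E] : formRank ω = finrank ℂ (LinearMap.range (bilin ω)) := by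
  have h1 := LinearMap.finrank_range_add_finrank_ker ω.curryLeft
  have h2 := LinearMap.finrank_range_add_finrank_ker (bilin ω)
  rw [ker_curryLeft] at h1
  rw [formRank]
  omega

/-- A form of corank one represents all functionals that vanish on a kernel vector. -/
lemma exists_kernel_vector [FiniteDimensional ℂ E] (h : formRank ω + 1 = finrank ℂ E) :
    ∃ κ : E, κ ≠ 0 ∧ ∀ l : Dual ℂ E, l κ = 0 → ∃ f, bilin ω f = l := by
  rw [formRank_eq] at h
  have h1 := LinearMap.finrank_range_add_finrank_ker (bilin ω)
  have h2 : 0 < finrank ℂ (LinearMap.ker (bilin ω)) := by omega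
  have h3 : LinearMap.ker (bilin ω) ≠ ⊥ := fun h => by rw [h, finrank_bot] at h2; omega
  obtain ⟨κ, hκ, hκ0⟩ := Submodule.exists_mem_ne_zero_of_ne_bot h3
  refine ⟨κ, hκ0, fun l hl => ?_⟩
  -- By skew-symmetry the range lies in the annihilator of `κ`; both are hyperplanes in the dual, so
  -- they agree.
  have hle : LinearMap.range (bilin ω) ≤ LinearMap.ker (Dual.eval ℂ E κ) := by
    rintro _ ⟨u, rfl⟩
    rw [LinearMap.mem_ker, Dual.eval_apply, bilin_swap, LinearMap.mem_ker.1 hκ]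
    simp
  have hsurj : LinearMap.range (Dual.eval ℂ E κ) = ⊤ := by
    rw [LinearMap.range_eq_top]
    refine LinearMap.surjective fun h => hκ0 ?_
    rw [← forall_dual_apply_eq_zero_iff ℂ κ]
    exact fun l => LinearMap.congr_fun h l
  have h4 := LinearMap.finrank_range_add_finrank_ker (Dual.eval ℂ E κ)
  rw [hsurj, finrank_top, finrank_self, Subspace.dual_finrank_eq] at h4
  have h5 := Submodule.eq_of_le_of_finrank_eq hle
    (Nat.add_left_cancel (n := 1) ((Eq.symm (by omega)).trans h4.symm))
  have h6 : l ∈ LinearMap.range (bilin ω) := by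
    rw [h5]
    exact hl
  exact h6

end Form

/-! ### A normal form for an isotropic flag -/

section Normal

variable {r : ℕ} {d : Fin (r + 1) → ℕ} {E : Type*} [AddCommGroup E] [Module ℂ E]

/-- A basis of `E` adapted to the flag `p` such that the coordinates with respect to the basis
vectors of `p.top`, with at most one exception `z`, are represented by further basis vectors. -/
structure NormalBasis (ω : E [⋀^Fin 2]→ₗ[ℂ] ℂ) (p : Flag d E) where
  /-- the basis -/
  basis : Basis (Fin (finrank ℂ E)) ℂ E
  adapted : ∀ i, p.V i = Submodule.span ℂ (basis '' {j | (j : ℕ) < d i})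
  /-- the exceptional index -/
  z : Fin (finrank ℂ E)
  /-- the index of the basis vector representing a coordinate -/
  e : Fin (finrank ℂ E) → Fin (finrank ℂ E)
  le_e : ∀ l : Fin (finrank ℂ E), (l : ℕ) < d (Fin.last r) → l ≠ z → d (Fin.last r) ≤ e l
  bilin_e : ∀ l : Fin (finrank ℂ E), (l : ℕ) < d (Fin.last r) → l ≠ z → ∀ y,
    bilin ω (basis (e l)) y = basis.repr y l

/-- Vectors dual to part of a basis of an isotropic subspace can be chosen isotropic. -/
lemma exists_isotropic_dual (ω : E [⋀^Fin 2]→ₗ[ℂ] ℂ) {I : Type*} [DecidableEq I] (L : Finset I)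
    (v g : I → E) (hv : ∀ i j, bilin ω (v i) (v j) = 0)
    (hg : ∀ l ∈ L, ∀ i, bilin ω (g l) (v i) = if i = l then 1 else 0) :
    ∃ f : I → E, (∀ l ∈ L, ∀ i, bilin ω (f l) (v i) = if i = l then 1 else 0) ∧
      ∀ l ∈ L, ∀ m ∈ L, bilin ω (f l) (f m) = 0 := by
  -- The correction of each of the two arguments contributes -½ ω(g l, g m), which together cancel
  -- ω(g l, g m). Pairings with the `v i` are unaffected, as these are isotropic.
  refine ⟨fun l => g l + ∑ m ∈ L, ((1 / 2 : ℂ) * bilin ω (g l) (g m)) • v m, ?_, ?_⟩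
  · intro l hl i
    simp [hg l hl, hv]
  · intro l hl m hm
    have hg' : ∀ l ∈ L, ∀ i, bilin ω (v i) (g l) = -if i = l then 1 else 0 := fun l hl i => by
      rw [bilin_swap, hg l hl]
    simp only [map_add, LinearMap.add_apply, map_sum, map_smul, LinearMap.sum_apply,
      LinearMap.smul_apply, hv, smul_eq_mul, mul_zero, Finset.sum_const_zero, add_zero]
    simp only [hg l hl, hg' m hm, mul_ite, mul_neg, mul_one, mul_zero,
      Finset.sum_neg_distrib, Finset.sum_ite_eq', hl, hm, if_true]
    rw [bilin_swap ω (g m) (g l)]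
    ring

/-- Pairing a linear relation with `v m` kills the terms in `v`, by isotropy, and isolates the
coefficient of `f m`. -/
lemma linearIndependent_sum_dual (ω : E [⋀^Fin 2]→ₗ[ℂ] ℂ) {I : Type*} [DecidableEq I]
    [Fintype I] (L : Finset I) {v f : I → E} (hli : LinearIndependent ℂ v)
    (hv : ∀ i j, bilin ω (v i) (v j) = 0)
    (hf : ∀ l ∈ L, ∀ i, bilin ω (f l) (v i) = if i = l then 1 else 0) :
    LinearIndependent ℂ (Sum.elim v fun l : L => f l) := by
  rw [Fintype.linearIndependent_iff]
  intro c hc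
  simp only [Fintype.sum_sum_type, Sum.elim_inl, Sum.elim_inr] at hc
  have h1 (m : L) : c (Sum.inr m) = 0 := by
    have h2 := congrArg (fun y => bilin ω y (v m)) hc
    simp only [map_add, map_sum, map_smul, LinearMap.add_apply, LinearMap.sum_apply,
      LinearMap.smul_apply, hv, smul_zero, Finset.sum_const_zero, zero_add, map_zero,
      LinearMap.zero_apply] at h2
    rw [Finset.sum_congr rfl fun (l : L) _ => by rw [hf l l.2]] at h2
    simpa using h2
  simp only [h1, zero_smul, Finset.sum_const_zero, add_zero] at hc
  rintro (i | m)
  · exact Fintype.linearIndependent_iff.1 hli _ hc i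
  · exact h1 m

variable [FiniteDimensional ℂ E]

/-- A linearly independent family indexed by a sum can be completed to a basis, with the first
summand as an initial segment. -/
lemma exists_basis_extending (b : Basis (Fin (finrank ℂ E)) ℂ E) (k : ℕ) {L : Type*}
    (f : L → E) (h : LinearIndependent ℂ
      (Sum.elim (fun i : {i : Fin (finrank ℂ E) // (i : ℕ) < k} => b i) f)) :
    ∃ (b' : Basis (Fin (finrank ℂ E)) ℂ E) (e : L → Fin (finrank ℂ E)),
      (∀ i : Fin (finrank ℂ E), (i : ℕ) < k → b' i = b i) ∧ (∀ l, k ≤ e l) ∧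
        ∀ l, b' (e l) = f l := by
  classical
  let B := Basis.sumExtend h
  have hfin : Finite (({i : Fin (finrank ℂ E) // (i : ℕ) < k} ⊕ L) ⊕ Basis.sumExtendIndex h) :=
    Module.Finite.finite_basis B
  have : Finite ({i : Fin (finrank ℂ E) // (i : ℕ) < k} ⊕ L) := 
    Finite.sum_left (Basis.sumExtendIndex h)
  have : Finite L := Finite.sum_right {i : Fin (finrank ℂ E) // (i : ℕ) < k}
  have : Finite (Basis.sumExtendIndex h) :=
    Finite.sum_right ({i : Fin (finrank ℂ E) // (i : ℕ) < k} ⊕ L)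
  have hcard := Module.finrank_eq_nat_card_basis B
  rw [Nat.card_sum, Nat.card_sum] at hcard
  have hcard2 := Nat.card_congr
    (Equiv.sumCompl fun i : Fin (finrank ℂ E) => (i : ℕ) < k)
  rw [Nat.card_sum, Nat.card_fin] at hcard2
  have hcard3 : Nat.card (L ⊕ Basis.sumExtendIndex h) =
      Nat.card {i : Fin (finrank ℂ E) // ¬ (i : ℕ) < k} := by
    rw [Nat.card_sum]
    omega
  obtain ⟨τ⟩ := (Finite.card_eq).1 hcard3
  let σ : ({i : Fin (finrank ℂ E) // (i : ℕ) < k} ⊕ L) ⊕ Basis.sumExtendIndex h ≃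
      Fin (finrank ℂ E) :=
    (Equiv.sumAssoc _ _ _).trans (((Equiv.refl _).sumCongr τ).trans
      (Equiv.sumCompl fun i : Fin (finrank ℂ E) => (i : ℕ) < k))
  have hB (a) : B (Sum.inl a) =
      Sum.elim (fun i : {i : Fin (finrank ℂ E) // (i : ℕ) < k} => b i) f a := by
    simp only [B, Basis.sumExtend, Basis.reindex_apply, Basis.extend_apply_self]
    rfl
  refine ⟨B.reindex σ, fun l => τ (Sum.inl l), fun i hi => ?_, fun l => ?_, fun l => ?_⟩
  · have h1 : σ (Sum.inl (Sum.inl ⟨i, hi⟩)) = i := rfl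
    rw [Basis.reindex_apply, ← h1, Equiv.symm_apply_apply, hB]
    rfl
  · exact not_lt.1 (τ (Sum.inl l)).2
  · have h1 : σ (Sum.inl (Sum.inr l)) = τ (Sum.inl l) := rfl
    beta_reduce
    rw [Basis.reindex_apply, ← h1, Equiv.symm_apply_apply, hB]
    rfl

/-- With a kernel vector as the basis vector `z`, every other coordinate functional vanishes on it
and is thus represented by the form. If `z` lies outside the top member, no index below `k` is
exceptional. -/
theorem exists_normalBasis (ω : E [⋀^Fin 2]→ₗ[ℂ] ℂ) (hω : formRank ω + 1 = finrank ℂ E)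
    (hd : Monotone d) (p : Flag d E) (hp : IsIsotropic ω p.top) : Nonempty (NormalBasis ω p) := by
  classical
  obtain ⟨κ, hκ, hrep⟩ := exists_kernel_vector ω hω
  obtain ⟨x, rfl, z, hz⟩ := exists_adaptedBasis_apply_eq p hκ
  set k := d (Fin.last r) with hk
  let b := x.basis
  let I := {i : Fin (finrank ℂ E) // (i : ℕ) < k}
  have hI (i j : I) : i = j ↔ (i : Fin (finrank ℂ E)) = j := Subtype.ext_iff
  let v : I → E := fun i => b i
  have hv (i j : I) : bilin ω (v i) (v j) = 0 := by
    have hmem (i : I) : v i ∈ x.flag.top := by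
      rw [Flag.top, x.adapted]
      exact Submodule.subset_span ⟨i, i.2, rfl⟩
    exact hp _ (hmem i) _ (hmem j)
  have hg (i : I) : ∃ g : E, (i : Fin (finrank ℂ E)) ≠ z → bilin ω g = b.coord i := by
    by_cases hi : (i : Fin (finrank ℂ E)) = z
    · exact ⟨0, fun h => absurd hi h⟩
    · obtain ⟨g, hg⟩ := hrep (b.coord i) (by simp [← hz, b, Ne.symm hi])
      exact ⟨g, fun _ => hg⟩
  choose g hg using hg
  let L : Finset I := Finset.univ.filter fun i => (i : Fin (finrank ℂ E)) ≠ z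
  have hL {l : I} : l ∈ L ↔ (l : Fin (finrank ℂ E)) ≠ z := by simp [L]
  obtain ⟨f, hf, hff⟩ := exists_isotropic_dual ω L v g hv fun l hl i => by
    rw [hg l (hL.1 hl)]
    simp only [v, Basis.coord_apply, Basis.repr_self, Finsupp.single_apply, hI]
  obtain ⟨b', e, hb', he, hbe⟩ := exists_basis_extending b k (fun l : L => f l)
    (linearIndependent_sum_dual ω L
      (b.linearIndependent.comp (Subtype.val : I → _) Subtype.val_injective) hv hf)
  -- The correction makes each `f l` orthogonal to all basis vectors beyond `k`, so that `f l`
  -- represents exactly the `l`-th coordinate of the new basis. The `f l` themselves are not moved,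
  -- being mutually orthogonal.
  let w : Fin (finrank ℂ E) → E := fun j =>
    if (j : ℕ) < k then b' j else b' j - ∑ l ∈ L, bilin ω (f l) (b' j) • v l
  have hw (j : Fin (finrank ℂ E)) (hj : (j : ℕ) < k) : w j = b j := by
    simp only [w, if_pos hj, hb' j hj]
  obtain ⟨b'', hb''⟩ := exists_basis_eq_of_span w (by
    rw [← b'.span_eq, Submodule.span_le]
    rintro _ ⟨j, rfl⟩
    by_cases hj : (j : ℕ) < k
    · exact Submodule.subset_span ⟨j, if_pos hj⟩
    · have h1 : b' j = w j + ∑ l ∈ L, bilin ω (f l) (b' j) • w l := by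
        rw [Finset.sum_congr rfl fun (l : I) _ => by rw [hw l l.2]]
        simp [w, hj, v]
      rw [h1]
      exact add_mem (Submodule.subset_span ⟨j, rfl⟩) (sum_mem fun l _ =>
        Submodule.smul_mem _ _ (Submodule.subset_span ⟨l, rfl⟩)))
  let e' : Fin (finrank ℂ E) → Fin (finrank ℂ E) := fun j =>
    if h : (j : ℕ) < k ∧ j ≠ z then e ⟨⟨j, h.1⟩, hL.2 h.2⟩ else j
  have he' (l : Fin (finrank ℂ E)) (hl : (l : ℕ) < k) (hlz : l ≠ z) :
      e' l = e ⟨⟨l, hl⟩, hL.2 hlz⟩ := dif_pos ⟨hl, hlz⟩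
  refine ⟨⟨b'', fun i => ?_, z, e', fun l hl hlz => ?_, fun l hl hlz => ?_⟩⟩
  · rw [x.adapted, hb'']
    congr 1
    refine Set.image_congr fun j hj => ?_
    have hj' : (j : ℕ) < d i := hj
    exact (hw j (hj'.trans_le (hd (Fin.le_last i)))).symm
  · rw [he' l hl hlz]
    exact he _
  · have hlL : (⟨l, hl⟩ : I) ∈ L := hL.2 hlz
    have h1 : b'' (e' l) = f ⟨l, hl⟩ := by
      have h2 : ¬ (e' l : ℕ) < k := by
        rw [he' l hl hlz]
        exact not_lt.2 (he _)
      simp only [hb'', w, if_neg h2]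
      rw [he' l hl hlz, hbe, Finset.sum_eq_zero, sub_zero]
      intro m hm
      rw [hff m hm _ hlL, zero_smul]
    have h2 : bilin ω (b'' (e' l)) = b''.coord l := by
      refine b''.ext fun j => ?_
      rw [h1, Basis.coord_apply, Basis.repr_self, Finsupp.single_apply, hb'']
      by_cases hj : (j : ℕ) < k
      · rw [hw j hj]
        have := hf _ hlL ⟨j, hj⟩
        simp only [hI] at this
        exact this
      · have hjl : j ≠ l := fun h => hj (h ▸ hl)
        simp only [w, if_neg hj, if_neg hjl, map_sub, map_sum, map_smul, hf _ hlL,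
          smul_eq_mul, mul_ite, mul_one, mul_zero]
        rw [Finset.sum_eq_single_of_mem _ hlL fun m _ h => if_neg h, if_pos rfl, sub_self]
    intro y
    rw [h2, Basis.coord_apply]

end Normal

/-! ### Vector-valued functions with components in an algebra of functions -/

section VecIn

variable {X E : Type*} [AddCommGroup E] [Module ℂ E] (𝒜 : Subalgebra ℂ (X → ℂ))

/-- The functions with values in `E` whose components belong to the algebra `𝒜`. -/
def VecIn (f : X → E) : Prop := ∀ l : Dual ℂ E, (fun x => l (f x)) ∈ 𝒜

variable {𝒜}

lemma vecIn_const (v : E) : VecIn 𝒜 fun _ : X => v := fun l => 𝒜.algebraMap_mem (l v)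

lemma VecIn.add {f g : X → E} (hf : VecIn 𝒜 f) (hg : VecIn 𝒜 g) :
    VecIn 𝒜 fun x => f x + g x := fun l => by
  simp only [map_add]
  exact add_mem (hf l) (hg l)

lemma VecIn.smul {c : X → ℂ} {f : X → E} (hc : c ∈ 𝒜) (hf : VecIn 𝒜 f) :
    VecIn 𝒜 fun x => c x • f x := fun l => by
  simp only [map_smul, smul_eq_mul]
  exact mul_mem hc (hf l)

lemma VecIn.sum {I : Type*} (s : Finset I) {f : I → X → E} (hf : ∀ i ∈ s, VecIn 𝒜 (f i)) :
    VecIn 𝒜 fun x => ∑ i ∈ s, f i x := fun l => by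
  simp only [map_sum]
  have : (fun x => ∑ i ∈ s, l (f i x)) = ∑ i ∈ s, fun x => l (f i x) := by
    ext x; simp
  rw [this]
  exact sum_mem fun i hi => hf i hi l

lemma VecIn.bilin [FiniteDimensional ℂ E] {f g : X → E} (hf : VecIn 𝒜 f) (hg : VecIn 𝒜 g)
    (B : E →ₗ[ℂ] E →ₗ[ℂ] ℂ) : (fun x => B (f x) (g x)) ∈ 𝒜 := by
  let b := finBasis ℂ E
  have h : (fun x => B (f x) (g x)) =
      ∑ i, (fun x => b.coord i (f x)) * fun x => B (b i) (g x) := by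
    ext x
    conv_lhs => rw [← b.sum_repr (f x)]
    simp only [map_sum, map_smul, LinearMap.sum_apply, LinearMap.smul_apply, smul_eq_mul,
      Finset.sum_apply, Pi.mul_apply, Basis.coord_apply]
  rw [h]
  exact sum_mem fun i _ => mul_mem (hf _) (hg _)

lemma ite_mem {P : Prop} [Decidable P] {f g : X → ℂ} (hf : P → f ∈ 𝒜) (hg : ¬ P → g ∈ 𝒜) :
    (fun x => if P then f x else g x) ∈ 𝒜 := by
  by_cases h : P
  · simpa [h] using! hf h
  · simpa [h] using! hg h

lemma det_mem {m : Type*} [Fintype m] [DecidableEq m] {M : m → m → X → ℂ}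
    (hM : ∀ i j, M i j ∈ 𝒜) : (fun x => (Matrix.of fun i j => M i j x).det) ∈ 𝒜 := by
  have h : (fun x => (Matrix.of fun i j => M i j x).det) =
      ∑ σ : Equiv.Perm m, ((Equiv.Perm.sign σ : ℤ) : ℂ) • ∏ i, M (σ i) i := by
    ext x
    simp [Matrix.det_apply']
  rw [h]
  exact sum_mem fun σ _ => 𝒜.smul_mem (prod_mem fun i _ => hM _ _) _

lemma adjugate_mem {m : Type*} [Fintype m] [DecidableEq m] {M : m → m → X → ℂ}
    (hM : ∀ i j, M i j ∈ 𝒜) (i j : m) :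
    (fun x => (Matrix.of fun i j => M i j x).adjugate i j) ∈ 𝒜 := by
  have h : (fun x => (Matrix.of fun i j => M i j x).adjugate i j) = fun x =>
      (Matrix.of fun a b => (if a = j then fun _ => (Pi.single i (1 : ℂ) : m → ℂ) b
        else M a b) x).det := by
    ext x
    rw [Matrix.adjugate_apply]
    congr 1
    ext a b
    by_cases h : a = j <;> simp [Matrix.updateRow_apply, h]
  rw [h]
  refine det_mem fun a b => ?_
  by_cases h : a = j
  · simp only [h, if_true]
    exact 𝒜.algebraMap_mem _
  · simpa [h] using! hM a b

lemma vecIn_polyFun {N : Type*} (j : N) : VecIn (polyFun (N → E)) fun w => w j := fun l =>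
  dual_mem_polyFun (l ∘ₗ (LinearMap.proj j : (N → E) →ₗ[ℂ] E))

variable (κ : Type*)

/-- The algebra of polynomial functions on the coordinate space `κ → ℂ`. -/
noncomputable def polyMaps : Subalgebra ℂ ((κ → ℂ) → ℂ) :=
  (AlgHom.pi fun x => MvPolynomial.aeval x : MvPolynomial κ ℂ →ₐ[ℂ] (κ → ℂ) → ℂ).range

variable {κ}

lemma mem_polyMaps {f : (κ → ℂ) → ℂ} :
    f ∈ polyMaps κ ↔ ∃ P : MvPolynomial κ ℂ, ∀ x, f x = MvPolynomial.eval x P := by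
  constructor
  · rintro ⟨P, rfl⟩
    exact ⟨P, fun x => rfl⟩
  · rintro ⟨P, hP⟩
    exact ⟨P, funext fun x => (hP x).symm⟩

lemma apply_mem_polyMaps (i : κ) : (fun x => x i) ∈ polyMaps κ :=
  mem_polyMaps.2 ⟨MvPolynomial.X i, fun x => by simp⟩

lemma comp_mem_of_polyFun {W : Type*} [AddCommGroup W] [Module ℂ W] {f : X → W}
    (hf : VecIn 𝒜 f) {P : W → ℂ} (hP : P ∈ polyFun W) : (fun x => P (f x)) ∈ 𝒜 := by
  induction hP using Algebra.adjoin_induction with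
  | mem _ h =>
    obtain ⟨l, rfl⟩ := h
    exact hf l
  | algebraMap c => exact 𝒜.algebraMap_mem c
  | add P Q _ _ hP hQ => exact add_mem hP hQ
  | mul P Q _ _ hP hQ => exact mul_mem hP hQ

lemma vecIn_pi {N : Type*} [Fintype N] [DecidableEq N] {f : X → N → E}
    (hf : ∀ j, VecIn 𝒜 fun x => f x j) : VecIn 𝒜 f := by
  intro l
  have h : (fun x => l (f x)) = ∑ j, fun x => (l ∘ₗ LinearMap.single ℂ (fun _ => E) j) (f x j) := by
    ext x
    rw [Finset.sum_apply]
    simp only [LinearMap.comp_apply, LinearMap.single_apply]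
    rw [← map_sum, Finset.univ_sum_single]
  rw [h]
  exact sum_mem fun j _ => hf j _

variable {r : ℕ} {d : Fin (r + 1) → ℕ}

/-- The functions that are regular near `p` form an algebra. -/
def regularAlg (p : Flag d E) : Subalgebra ℂ (Flag d E → ℂ) :=
  { regularAt p with algebraMap_mem' := const_mem_regularAt }

lemma mem_regularAlg {p : Flag d E} {f : Flag d E → ℂ} : f ∈ regularAlg p ↔ f ∈ regularAt p :=
  Iff.rfl

end VecIn

/-! ### Flags as graphs -/

section Graph

variable {r : ℕ} {d : Fin (r + 1) → ℕ} {E : Type*} [AddCommGroup E] [Module ℂ E]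
variable (b : Basis (Fin (finrank ℂ E)) ℂ E)

/-- The flags whose members are graphs over the coordinate subspaces of the basis `b`. -/
def Transversal (q : Flag d E) : Prop :=
  ∀ a, ∀ y ∈ q.V a, (∀ j : Fin (finrank ℂ E), (j : ℕ) < d a → b.repr y j = 0) → y = 0

open Classical in
/-- The vector of the `a`-th member of a flag whose first coordinates are those of `v`. -/
noncomputable def graphVec (a : Fin (r + 1)) (v : E) (q : Flag d E) : E :=
  if h : ∃ y ∈ q.V a, ∀ j : Fin (finrank ℂ E), (j : ℕ) < d a → b.repr y j = b.repr v j then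
    h.choose else 0

lemma graphVec_mem (a : Fin (r + 1)) (v : E) (q : Flag d E) : graphVec b a v q ∈ q.V a := by
  by_cases h : ∃ y ∈ q.V a, ∀ j : Fin (finrank ℂ E), (j : ℕ) < d a → b.repr y j = b.repr v j
  · rw [graphVec, dif_pos h]
    exact h.choose_spec.1
  · rw [graphVec, dif_neg h]
    exact zero_mem _

variable {b}

lemma Transversal.eq_of_repr_eq {q : Flag d E} (h : Transversal b q) {a : Fin (r + 1)} {y y' : E}
    (hy : y ∈ q.V a) (hy' : y' ∈ q.V a)
    (hyy : ∀ j : Fin (finrank ℂ E), (j : ℕ) < d a → b.repr y j = b.repr y' j) : y = y' :=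
  sub_eq_zero.1 (h a _ (sub_mem hy hy') fun j hj => by simp [hyy j hj])

lemma Transversal.graphVec_eq {q : Flag d E} (h : Transversal b q) {a : Fin (r + 1)} {v y : E}
    (hy : y ∈ q.V a)
    (hyv : ∀ j : Fin (finrank ℂ E), (j : ℕ) < d a → b.repr y j = b.repr v j) :
    graphVec b a v q = y := by
  have hex : ∃ y ∈ q.V a, ∀ j : Fin (finrank ℂ E), (j : ℕ) < d a → b.repr y j = b.repr v j :=
    ⟨y, hy, hyv⟩
  refine h.eq_of_repr_eq (graphVec_mem b a v q) hy fun j hj => ?_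
  rw [hyv j hj, graphVec, dif_pos hex]
  exact hex.choose_spec.2 j hj

variable (b) in
/-- The matrix of the first coordinates of the basis vectors spanning the `a`-th member of a
flag. -/
noncomputable def minorMatrix (a : Fin (r + 1)) (w : Fin (finrank ℂ E) → E) :
    Matrix {l : Fin (finrank ℂ E) // (l : ℕ) < d a} {l : Fin (finrank ℂ E) // (l : ℕ) < d a} ℂ :=
  Matrix.of fun j l => b.repr (w l) j

lemma AdaptedBasis.mem_V_iff (x : AdaptedBasis d E) {a : Fin (r + 1)} {y : E} :
    y ∈ x.flag.V a ↔ ∃ c : {l : Fin (finrank ℂ E) // (l : ℕ) < d a} → ℂ,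
      y = ∑ l, c l • x.basis l := by
  have h : x.basis '' {j | (j : ℕ) < d a} =
      Set.range fun l : {l : Fin (finrank ℂ E) // (l : ℕ) < d a} => x.basis l := by
    ext y; simp
  rw [x.adapted, h, Submodule.mem_span_range_iff_exists_fun]
  simp only [eq_comm]

lemma repr_sum_eq_mulVec (x : AdaptedBasis d E) {a : Fin (r + 1)}
    (c : {l : Fin (finrank ℂ E) // (l : ℕ) < d a} → ℂ)
    (j : {l : Fin (finrank ℂ E) // (l : ℕ) < d a}) :
    b.repr (∑ l, c l • x.basis l) j = (minorMatrix b a x.vec).mulVec c j := by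
  simp [Matrix.mulVec, dotProduct, minorMatrix, AdaptedBasis.vec, mul_comm]

/-- Coefficients in the adapted basis identify the kernel of the minor matrix with the vectors of
the member whose first coordinates vanish. -/
lemma transversal_iff (x : AdaptedBasis d E) :
    Transversal b x.flag ↔ ∀ a : Fin (r + 1), (minorMatrix (d := d) b a x.vec).det ≠ 0 := by
  constructor
  · intro h a hdet
    obtain ⟨c, hc0, hc⟩ := Matrix.exists_mulVec_eq_zero_iff.2 hdet
    have h1 := h a _ (x.mem_V_iff.2 ⟨c, rfl⟩) fun j hj => by
      have := repr_sum_eq_mulVec (b := b) x c ⟨j, hj⟩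
      rw [hc] at this
      exact this
    have hli := x.basis.linearIndependent.comp
      (Subtype.val : {l : Fin (finrank ℂ E) // (l : ℕ) < d a} → _) Subtype.val_injective
    exact hc0 (funext (Fintype.linearIndependent_iff.1 hli c h1))
  · intro h a y hy hy0
    obtain ⟨c, rfl⟩ := x.mem_V_iff.1 hy
    have h1 : (minorMatrix b a x.vec).mulVec c = 0 := by
      funext j
      rw [← repr_sum_eq_mulVec]
      exact hy0 j j.2
    rw [Matrix.eq_zero_of_mulVec_eq_zero (h a) h1]
    simp

lemma graphVec_flag (x : AdaptedBasis d E) (h : Transversal b x.flag) (a : Fin (r + 1)) (v : E) :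
    graphVec b a v x.flag =
      ∑ l, ((minorMatrix (d := d) b a x.vec)⁻¹.mulVec fun j => b.repr v j) l • x.basis l := by
  refine h.graphVec_eq (x.mem_V_iff.2 ⟨_, rfl⟩) fun j hj => ?_
  have h1 := repr_sum_eq_mulVec (b := b) x
    ((minorMatrix (d := d) b a x.vec)⁻¹.mulVec fun j => b.repr v j) ⟨j, hj⟩
  rw [Matrix.mulVec_mulVec, Matrix.mul_nonsing_inv _ ((transversal_iff x).1 h a).isUnit,
    Matrix.one_mulVec] at h1
  exact h1

lemma repr_graphVec [FiniteDimensional ℂ E] {q : Flag d E} (h : Transversal b q)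
    {a : Fin (r + 1)} {v : E} {j : Fin (finrank ℂ E)} (hj : (j : ℕ) < d a) :
    b.repr (graphVec b a v q) j = b.repr v j := by
  obtain ⟨x, rfl⟩ := exists_adaptedBasis q
  rw [graphVec_flag x h]
  have h1 := repr_sum_eq_mulVec (b := b) x
    ((minorMatrix (d := d) b a x.vec)⁻¹.mulVec fun j => b.repr v j) ⟨j, hj⟩
  rw [Matrix.mulVec_mulVec, Matrix.mul_nonsing_inv _ ((transversal_iff x).1 h a).isUnit,
    Matrix.one_mulVec] at h1
  exact h1

lemma minorMatrix_mem_polyFun (a : Fin (r + 1))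
    (i j : {l : Fin (finrank ℂ E) // (l : ℕ) < d a}) :
    (fun w : Fin (finrank ℂ E) → E => minorMatrix b a w i j) ∈ polyFun (Fin (finrank ℂ E) → E) :=
  vecIn_polyFun (j : Fin (finrank ℂ E)) (b.coord i)

lemma isOpen_transversal : IsOpen {q : Flag d E | Transversal b q} := by
  refine isOpen_flag_of_exists_polyFun fun x hx => ?_
  refine ⟨fun w => ∏ a : Fin (r + 1), (minorMatrix (d := d) b a w).det, ?_, ?_, ?_⟩
  · have h : (fun w => ∏ a : Fin (r + 1), (minorMatrix (d := d) b a w).det) =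
        ∏ a : Fin (r + 1), fun w => (minorMatrix (d := d) b a w).det := by
      ext w; simp
    rw [h]
    exact prod_mem fun a _ => det_mem fun i j => minorMatrix_mem_polyFun a i j
  · exact Finset.prod_ne_zero_iff.2 fun a _ => (transversal_iff x).1 hx a
  · exact fun y hy => (transversal_iff y).2 fun a =>
      Finset.prod_ne_zero_iff.1 hy a (Finset.mem_univ a)

/-- By Cramer's rule the components are polynomials in the adapted basis divided by one minor, which
is nonzero on all transversal flags. This provides both regular coordinates and regular sections of
T. -/
lemma vecIn_graphVec {p : Flag d E} (hp : Transversal b p) (a : Fin (r + 1)) (v : E) :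
    VecIn (regularAlg p) (graphVec b a v) := by
  intro l
  refine ⟨{q | Transversal b q}, isOpen_transversal, hp, fun x hx => ?_⟩
  refine ⟨fun w => ∑ i : {i : Fin (finrank ℂ E) // (i : ℕ) < d a},
    (∑ j : {j : Fin (finrank ℂ E) // (j : ℕ) < d a},
      (minorMatrix b a w).adjugate i j * b.repr v j) * l (w i), ?_,
    fun w => (minorMatrix b a w).det, det_mem fun i j => minorMatrix_mem_polyFun a i j,
    (transversal_iff x).1 hx a, fun y hy _ => ?_⟩
  · have h : (fun w => ∑ i : {i : Fin (finrank ℂ E) // (i : ℕ) < d a},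
        (∑ j : {j : Fin (finrank ℂ E) // (j : ℕ) < d a},
        (minorMatrix b a w).adjugate i j * b.repr v j) * l (w i)) =
        ∑ i : {i : Fin (finrank ℂ E) // (i : ℕ) < d a},
        (∑ j : {j : Fin (finrank ℂ E) // (j : ℕ) < d a},
        (fun w : Fin (finrank ℂ E) → E => (minorMatrix b a w).adjugate i j) *
          fun _ => b.repr v j) * fun w => l (w i) := by
      ext w; simp [Finset.sum_apply]
    rw [h]
    exact sum_mem fun i _ => mul_mem (sum_mem fun j _ =>
      mul_mem (adjugate_mem (fun i j => minorMatrix_mem_polyFun a i j) i j)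
        (const_mem_polyFun _)) (vecIn_polyFun _ l)
  · have hdet := (transversal_iff y).1 hy a
    beta_reduce
    rw [graphVec_flag y hy]
    refine (eq_div_iff hdet).2 ?_
    rw [Matrix.inv_def, map_sum, Finset.sum_mul]
    refine Finset.sum_congr rfl fun i _ => ?_
    rw [map_smul, Matrix.smul_mulVec, Pi.smul_apply, smul_eq_mul, smul_eq_mul,
      Ring.inverse_eq_inv']
    have key (D A L : ℂ) (hD : D ≠ 0) : D⁻¹ * A * L * D = A * L := by field_simp
    exact key _ _ _ hdet

lemma transversal_of_adapted (x : AdaptedBasis d E) : Transversal x.basis x.flag := by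
  rw [transversal_iff]
  intro a
  have h : minorMatrix x.basis a x.vec =
      (1 : Matrix {l : Fin (finrank ℂ E) // (l : ℕ) < d a} _ ℂ) := by
    ext i j
    simp [minorMatrix, AdaptedBasis.vec, Finsupp.single_apply, Matrix.one_apply, Subtype.ext_iff,
      eq_comm]
  rw [h, Matrix.det_one]
  exact one_ne_zero

end Graph

/-! ### The chart attached to a normal basis -/

section Block

variable {r : ℕ}

/-- The bound on `i` is placed inside the conclusion to make `block` total; beyond the top member
the value 0 is a placeholder. -/
lemma exists_block {d : Fin (r + 1) → ℕ} (i : ℕ) :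
    ∃ a, i < d (Fin.last r) → i < d a ∧ ∀ a', i < d a' → a ≤ a' := by
  classical
  by_cases h : i < d (Fin.last r)
  · obtain ⟨a, ha, hmin⟩ := Finset.exists_min_image (Finset.univ.filter fun a => i < d a) id
      ⟨Fin.last r, by simpa using h⟩
    exact ⟨a, fun _ => ⟨(Finset.mem_filter.1 ha).2, fun a' ha' => hmin a' (by simpa using ha')⟩⟩
  · exact ⟨0, fun h' => absurd h' h⟩

/-- The first member of a flag of type `d` that contains the `i`-th basis vector. -/
noncomputable def block (d : Fin (r + 1) → ℕ) (i : ℕ) : Fin (r + 1) :=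
  (exists_block (d := d) i).choose

variable {d : Fin (r + 1) → ℕ} {i : ℕ}

lemma lt_block (hi : i < d (Fin.last r)) : i < d (block d i) :=
  ((exists_block (d := d) i).choose_spec hi).1

lemma block_le {a : Fin (r + 1)} (hd : Monotone d) (hi : i < d a) : block d i ≤ a :=
  ((exists_block (d := d) i).choose_spec (hi.trans_le (hd (Fin.le_last a)))).2 a hi

/-- The positions of the entries of a matrix that are used as coordinates of a flag. -/
abbrev ChartIndex (d : Fin (r + 1) → ℕ) (N : ℕ) : Type :=
  {c : Fin N × Fin N // (c.2 : ℕ) < d (Fin.last r) ∧ d (block d c.2) ≤ c.1}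

open Classical in
/-- The matrix entry at a given position, zero if it is not a coordinate. -/
noncomputable def entry {N : ℕ} (x : ChartIndex d N → ℂ) (j i : Fin N) : ℂ :=
  if h : (i : ℕ) < d (Fin.last r) ∧ d (block d i) ≤ j then x ⟨(j, i), h⟩ else 0

lemma entry_eq {N : ℕ} (x : ChartIndex d N → ℂ) (c : ChartIndex d N) :
    entry x c.1.1 c.1.2 = x c := dif_pos c.2

lemma entry_mem_polyMaps {N : ℕ} (j i : Fin N) :
    (fun x : ChartIndex d N → ℂ => entry x j i) ∈ polyMaps (ChartIndex d N) := by
  by_cases h : (i : ℕ) < d (Fin.last r) ∧ d (block d i) ≤ j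
  · simpa only [entry, dif_pos h] using apply_mem_polyMaps _
  · simp only [entry, dif_neg h]
    exact zero_mem _

end Block

/-! ### The polynomial parametrization of flags by matrix entries and values of the form -/

namespace NormalBasis

open Classical

variable {r : ℕ} {d : Fin (r + 1) → ℕ} {E : Type*} [AddCommGroup E] [Module ℂ E]
  {ω : E [⋀^Fin 2]→ₗ[ℂ] ℂ} {p : Flag d E} (nb : NormalBasis ω p)

/-- The order of the basis vectors, with the exceptional one first. -/
noncomputable def rank (i : Fin (finrank ℂ E)) : ℕ := if i = nb.z then 0 else i + 1

/-- The pairs of different basis vectors of the isotropic subspace, in order. -/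
def Rel (i m : Fin (finrank ℂ E)) : Prop :=
  (i : ℕ) < d (Fin.last r) ∧ (m : ℕ) < d (Fin.last r) ∧ nb.rank i < nb.rank m

/-- The positions of the coordinates that vanish on isotropic flags. -/
def Special (j i : Fin (finrank ℂ E)) : Prop := ∃ m, nb.Rel i m ∧ nb.e m = j

variable {nb}

/-- The exceptional index has rank 0, so it is never second in a pair, and the second index always
has a dual basis vector. -/
lemma Rel.ne_z {i m : Fin (finrank ℂ E)} (h : nb.Rel i m) : m ≠ nb.z := by
  rintro rfl
  have := h.2.2
  simp [rank] at this

lemma rank_injective : Function.Injective nb.rank := by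
  intro i j h
  unfold rank at h
  split_ifs at h with h1 h2 h2
  · rw [h1, h2]
  · exact Fin.ext (by omega)

lemma Rel.le_e {i m : Fin (finrank ℂ E)} (h : nb.Rel i m) : d (Fin.last r) ≤ nb.e m :=
  nb.le_e m h.2.1 h.ne_z

/-- Different coordinate functionals cannot be represented by the same vector. -/
lemma Rel.e_injective {i m i' m' : Fin (finrank ℂ E)} (h : nb.Rel i m) (h' : nb.Rel i' m')
    (he : nb.e m = nb.e m') : m = m' := by
  have h1 := nb.bilin_e m h.2.1 h.ne_z (nb.basis m)
  rw [he, nb.bilin_e m' h'.2.1 h'.ne_z] at h1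
  by_contra hne
  simp [hne] at h1

lemma Special.le {i j : Fin (finrank ℂ E)} (h : nb.Special j i) : d (Fin.last r) ≤ j := by
  obtain ⟨m, hm, rfl⟩ := h
  exact hm.le_e

lemma repr_basis {i j : Fin (finrank ℂ E)} :
    nb.basis.repr (nb.basis i) j = if i = j then 1 else 0 := by
  rw [Basis.repr_self, Finsupp.single_apply]

variable (nb)

/-- A linear combination of the basis vectors dual to those that come after `i`. -/
noncomputable def tail (c : Fin (finrank ℂ E) → ℂ) (i : Fin (finrank ℂ E)) : E :=
  ∑ m, (if nb.Rel i m then c m else 0) • nb.basis (nb.e m)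

variable {nb}

lemma bilin_tail (c : Fin (finrank ℂ E) → ℂ) (i : Fin (finrank ℂ E)) (y : E) :
    bilin ω (nb.tail c i) y = ∑ m, (if nb.Rel i m then c m else 0) * nb.basis.repr y m := by
  simp only [tail, map_sum, map_smul, LinearMap.sum_apply, LinearMap.smul_apply, smul_eq_mul]
  refine Finset.sum_congr rfl fun m _ => ?_
  split_ifs with h
  · rw [nb.bilin_e m h.2.1 h.ne_z]
  · rw [zero_mul, zero_mul]

lemma repr_tail (c : Fin (finrank ℂ E) → ℂ) (i j : Fin (finrank ℂ E)) :
    nb.basis.repr (nb.tail c i) j =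
      ∑ m, (if nb.Rel i m then c m else 0) * if nb.e m = j then 1 else 0 := by
  simp only [tail, map_sum, map_smul, Finsupp.coe_finsetSum, Finset.sum_apply, Finsupp.smul_apply,
    smul_eq_mul, repr_basis]

lemma repr_tail_of_not_special (c : Fin (finrank ℂ E) → ℂ) {i j : Fin (finrank ℂ E)}
    (h : ¬ nb.Special j i) : nb.basis.repr (nb.tail c i) j = 0 := by
  rw [repr_tail]
  refine Finset.sum_eq_zero fun m _ => ?_
  by_cases h1 : nb.Rel i m
  · rw [if_neg fun h2 => h ⟨m, h1, h2⟩, mul_zero]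
  · rw [if_neg h1, zero_mul]

lemma repr_tail_of_lt (c : Fin (finrank ℂ E) → ℂ) {i j : Fin (finrank ℂ E)}
    (hj : (j : ℕ) < d (Fin.last r)) : nb.basis.repr (nb.tail c i) j = 0 :=
  repr_tail_of_not_special c fun h => absurd h.le (not_le.2 hj)

lemma repr_tail_e (c : Fin (finrank ℂ E) → ℂ) {i m : Fin (finrank ℂ E)} (h : nb.Rel i m) :
    nb.basis.repr (nb.tail c i) (nb.e m) = c m := by
  rw [repr_tail, Finset.sum_eq_single m]
  · simp [h]
  · intro m' _ hne
    by_cases h1 : nb.Rel i m'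
    · rw [if_neg fun h2 => hne (h1.e_injective h h2), mul_zero]
    · rw [if_neg h1, zero_mul]
  · simp

/-- The effect on the form of adding combinations of dual basis vectors. -/
lemma bilin_add_tail {w u : Fin (finrank ℂ E) → E}
    {c : Fin (finrank ℂ E) → Fin (finrank ℂ E) → ℂ}
    (hw : ∀ i j : Fin (finrank ℂ E), (i : ℕ) < d (Fin.last r) → (j : ℕ) < d (Fin.last r) →
      nb.basis.repr (w i) j = if i = j then 1 else 0)
    (hu : ∀ i : Fin (finrank ℂ E), (i : ℕ) < d (Fin.last r) → u i = w i + nb.tail (c i) i)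
    {i m : Fin (finrank ℂ E)} (him : nb.Rel i m) :
    bilin ω (u i) (u m) = bilin ω (w i) (w m) + c i m := by
  have h1 : bilin ω (nb.tail (c i) i) (w m) = c i m := by
    rw [bilin_tail, Finset.sum_eq_single m]
    · simp [him, hw m m him.2.1 him.2.1]
    · intro l _ hl
      by_cases h : nb.Rel i l
      · rw [hw m l him.2.1 h.2.1, if_neg hl.symm, mul_zero]
      · rw [if_neg h, zero_mul]
    · simp
  -- Tails involve only basis vectors beyond the top member of `p`, so the coordinates read off by
  -- the pairing vanish.
  have h2 : bilin ω (nb.tail (c i) i) (nb.tail (c m) m) = 0 := by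
    rw [bilin_tail]
    refine Finset.sum_eq_zero fun l _ => ?_
    by_cases h : nb.Rel i l
    · rw [repr_tail_of_lt _ h.2.1, mul_zero]
    · rw [if_neg h, zero_mul]
  -- A nonzero term would need `i` to come after `m`; this triangularity is the purpose of the
  -- order.
  have h3 : bilin ω (w i) (nb.tail (c m) m) = 0 := by
    rw [bilin_swap, bilin_tail, neg_eq_zero]
    refine Finset.sum_eq_zero fun l _ => ?_
    by_cases h : nb.Rel m l
    · have hil : i ≠ l := by
        rintro rfl
        exact lt_asymm h.2.2 him.2.2
      rw [hw i l him.1 h.2.1, if_neg hil, mul_zero]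
    · rw [if_neg h, zero_mul]
  rw [hu i him.1, hu m him.2.1]
  simp only [map_add, LinearMap.add_apply, h1, h2, h3]
  ring

variable (nb)

/-- The graph of a matrix, with the entries at the special positions set to zero. -/
noncomputable def wVec (x : ChartIndex d (finrank ℂ E) → ℂ) (i : Fin (finrank ℂ E)) : E :=
  nb.basis i + ∑ j : Fin (finrank ℂ E),
    (if d (Fin.last r) ≤ j ∧ ¬ nb.Special j i then entry x j i else 0) • nb.basis j

/-- A basis of a complement to the coordinate subspace, such that the values of the form on pairs of
basis vectors are the coordinates at the special positions. -/
noncomputable def uVec (x : ChartIndex d (finrank ℂ E) → ℂ) (i : Fin (finrank ℂ E)) : E :=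
  nb.wVec x i + nb.tail (fun m => entry x (nb.e m) i - bilin ω (nb.wVec x i) (nb.wVec x m)) i

/-- The basis of `E` attached to a point of the chart. -/
noncomputable def yVec (x : ChartIndex d (finrank ℂ E) → ℂ) (i : Fin (finrank ℂ E)) : E :=
  if (i : ℕ) < d (Fin.last r) then nb.uVec x i + ∑ j : Fin (finrank ℂ E),
    (if d (block d i) ≤ j ∧ (j : ℕ) < d (Fin.last r) then entry x j i else 0) • nb.uVec x j
  else nb.basis i

variable {nb}

lemma repr_sum_smul_basis (c : Fin (finrank ℂ E) → ℂ) (j : Fin (finrank ℂ E)) :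
    nb.basis.repr (∑ j, c j • nb.basis j) j = c j :=
  congrFun (nb.basis.repr_sum_self c) j

variable {x : ChartIndex d (finrank ℂ E) → ℂ} {i j : Fin (finrank ℂ E)}

lemma repr_wVec_of_lt (hj : (j : ℕ) < d (Fin.last r)) :
    nb.basis.repr (nb.wVec x i) j = if i = j then 1 else 0 := by
  rw [wVec, map_add, Finsupp.add_apply, repr_sum_smul_basis, repr_basis,
    if_neg (c := d (Fin.last r) ≤ j ∧ ¬ nb.Special j i) fun h => absurd h.1 (not_le.2 hj),
    add_zero]

lemma repr_wVec_of_le (hi : (i : ℕ) < d (Fin.last r)) (hj : d (Fin.last r) ≤ j) :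
    nb.basis.repr (nb.wVec x i) j = if nb.Special j i then 0 else entry x j i := by
  have hij : i ≠ j := by rintro rfl; omega
  rw [wVec, map_add, Finsupp.add_apply, repr_sum_smul_basis, repr_basis, if_neg hij, zero_add]
  by_cases h : nb.Special j i <;> simp [h, hj]

lemma repr_uVec_of_lt (hj : (j : ℕ) < d (Fin.last r)) :
    nb.basis.repr (nb.uVec x i) j = if i = j then 1 else 0 := by
  rw [uVec, map_add, Finsupp.add_apply, repr_wVec_of_lt hj, repr_tail_of_lt _ hj, add_zero]

lemma repr_uVec_of_not_special (hi : (i : ℕ) < d (Fin.last r)) (hj : d (Fin.last r) ≤ j)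
    (h : ¬ nb.Special j i) : nb.basis.repr (nb.uVec x i) j = entry x j i := by
  rw [uVec, map_add, Finsupp.add_apply, repr_wVec_of_le hi hj, if_neg h,
    repr_tail_of_not_special _ h, add_zero]

/-- Adding tails changes ω(w i, w m) by the tail coefficient, and that coefficient was chosen as the
desired entry minus ω(w i, w m). -/
lemma bilin_uVec {m : Fin (finrank ℂ E)} (h : nb.Rel i m) :
    bilin ω (nb.uVec x i) (nb.uVec x m) = entry x (nb.e m) i := by
  have h1 := bilin_add_tail (nb := nb) (w := nb.wVec x) (u := nb.uVec x)
    (fun i j _ hj => repr_wVec_of_lt hj) (fun i _ => rfl) h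
  rw [h1]
  ring

lemma repr_yVec_of_lt (hi : (i : ℕ) < d (Fin.last r)) (hj : (j : ℕ) < d (Fin.last r)) :
    nb.basis.repr (nb.yVec x i) j =
      (if i = j then 1 else 0) + if d (block d i) ≤ j then entry x j i else 0 := by
  rw [yVec, if_pos hi, map_add, Finsupp.add_apply, repr_uVec_of_lt hj]
  congr 1
  simp only [map_sum, map_smul, Finsupp.coe_finsetSum, Finset.sum_apply, Finsupp.smul_apply,
    smul_eq_mul, repr_uVec_of_lt hj]
  rw [Finset.sum_eq_single j]
  · simp [hj]
  · intro l _ hl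
    rw [if_neg hl, mul_zero]
  · simp

lemma repr_yVec_of_lt_of_lt (hj : (j : ℕ) < i) : nb.basis.repr (nb.yVec x i) j = 0 := by
  have hji : i ≠ j := by rintro rfl; omega
  by_cases hi : (i : ℕ) < d (Fin.last r)
  · have h1 : ¬ d (block d i) ≤ j := by
      have := lt_block hi
      omega
    rw [repr_yVec_of_lt hi (by omega), if_neg hji, if_neg h1, add_zero]
  · rw [yVec, if_neg hi, repr_basis, if_neg hji]

lemma repr_yVec_self : nb.basis.repr (nb.yVec x i) i = 1 := by
  by_cases hi : (i : ℕ) < d (Fin.last r)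
  · have h1 : ¬ d (block d i) ≤ i := by
      have := lt_block hi
      omega
    rw [repr_yVec_of_lt hi hi, if_pos rfl, if_neg h1, add_zero]
  · rw [yVec, if_neg hi, repr_basis, if_pos rfl]

/-- The family is unitriangular in the normal basis, because `i < d (block d i)` for indices in the
top member. -/
lemma yVec_span : ⊤ ≤ Submodule.span ℂ (Set.range (nb.yVec x)) := by
  have h : IsUnit (nb.basis.det (nb.yVec x)) := by
    rw [Basis.det_apply, Matrix.det_of_isLowerTriangular]
    · simp [Basis.toMatrix_apply, repr_yVec_self]
    · intro i j hij
      rw [Basis.toMatrix_apply]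
      exact repr_yVec_of_lt_of_lt hij
  exact ((Basis.is_basis_iff_det nb.basis).2 h).2.ge

end NormalBasis

/-! ### The coordinates of a flag, inverse to the parametrization -/

namespace NormalBasis

open Classical

variable {r : ℕ} {d : Fin (r + 1) → ℕ} {E : Type*} [AddCommGroup E] [Module ℂ E]
  {ω : E [⋀^Fin 2]→ₗ[ℂ] ℂ} {p : Flag d E} (nb : NormalBasis ω p)

lemma dim_le [FiniteDimensional ℂ E] (p : Flag d E) (i : Fin (r + 1)) : d i ≤ finrank ℂ E :=
  p.finrank_eq i ▸ Submodule.finrank_le _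

/-- The vector of the largest member of a flag that is the graph over the `i`-th basis vector. -/
noncomputable def tVec (i : Fin (finrank ℂ E)) (q : Flag d E) : E :=
  graphVec nb.basis (Fin.last r) (nb.basis i) q

/-- The vector that is the graph over the `i`-th basis vector, in the smallest possible member of a
flag. -/
noncomputable def sVec (i : Fin (finrank ℂ E)) (q : Flag d E) : E :=
  graphVec nb.basis (block d i) (nb.basis i) q

/-- The coordinates of a flag. -/
noncomputable def coord (q : Flag d E) (c : ChartIndex d (finrank ℂ E)) : ℂ :=
  if h : nb.Special c.1.1 c.1.2 then bilin ω (nb.tVec c.1.2 q) (nb.tVec h.choose q)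
  else if d (Fin.last r) ≤ c.1.1 then nb.basis.repr (nb.tVec c.1.2 q) c.1.1
  else nb.basis.repr (nb.sVec c.1.2 q) c.1.1

variable {nb} {x : ChartIndex d (finrank ℂ E) → ℂ} {q : Flag d E}
  {i j m : Fin (finrank ℂ E)}

lemma entry_coord_special (hd : Monotone d) (h : nb.Rel i m) :
    entry (nb.coord q) (nb.e m) i = bilin ω (nb.tVec i q) (nb.tVec m q) := by
  have h0 : (i : ℕ) < d (Fin.last r) ∧ d (block d i) ≤ nb.e m :=
    ⟨h.1, (hd (Fin.le_last _)).trans h.le_e⟩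
  have hs : nb.Special (nb.e m) i := ⟨m, h, rfl⟩
  rw [entry, dif_pos h0, coord, dif_pos hs]
  -- The index chosen in `coord` must be `m`, by injectivity of `e` on related pairs.
  rw [hs.choose_spec.1.e_injective h hs.choose_spec.2]

lemma entry_coord_of_le (hd : Monotone d) (hi : (i : ℕ) < d (Fin.last r)) (hj : d (Fin.last r) ≤ j)
    (h : ¬ nb.Special j i) : entry (nb.coord q) j i = nb.basis.repr (nb.tVec i q) j := by
  have h0 : (i : ℕ) < d (Fin.last r) ∧ d (block d i) ≤ j := ⟨hi, (hd (Fin.le_last _)).trans hj⟩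
  rw [entry, dif_pos h0, coord, dif_neg h, if_pos hj]

lemma entry_coord_of_lt (hi : (i : ℕ) < d (Fin.last r)) (hij : d (block d i) ≤ j)
    (hj : (j : ℕ) < d (Fin.last r)) :
    entry (nb.coord q) j i = nb.basis.repr (nb.sVec i q) j := by
  rw [entry, dif_pos ⟨hi, hij⟩, coord, dif_neg fun h => absurd h.le (not_le.2 hj),
    if_neg (not_le.2 hj)]

variable (nb) in
lemma transversal_center : Transversal nb.basis p :=
  transversal_of_adapted ⟨nb.basis, p, nb.adapted⟩

lemma basis_mem {a : Fin (r + 1)} (hi : (i : ℕ) < d a) : nb.basis i ∈ p.V a := by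
  rw [nb.adapted]
  exact Submodule.subset_span ⟨i, hi, rfl⟩

lemma vecIn_tail {X : Type*} {𝒜 : Subalgebra ℂ (X → ℂ)} {c : Fin (finrank ℂ E) → X → ℂ}
    (hc : ∀ m, c m ∈ 𝒜) : VecIn 𝒜 fun x => nb.tail (fun m => c m x) i :=
  VecIn.sum _ fun m _ => VecIn.smul (ite_mem (fun _ => hc m) fun _ => zero_mem 𝒜) (vecIn_const _)

lemma vecIn_wVec : VecIn (polyMaps _) fun x => nb.wVec x i :=
  (vecIn_const _).add (VecIn.sum _ fun j _ => VecIn.smul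
    (ite_mem (fun _ => entry_mem_polyMaps j i) fun _ => zero_mem _) (vecIn_const _))

lemma rel_or_eq_or_rel (hi : (i : ℕ) < d (Fin.last r)) (hm : (m : ℕ) < d (Fin.last r)) :
    nb.Rel i m ∨ i = m ∨ nb.Rel m i := by
  rcases lt_trichotomy (nb.rank i) (nb.rank m) with h | h | h
  · exact Or.inl ⟨hi, hm, h⟩
  · exact Or.inr (Or.inl (rank_injective h))
  · exact Or.inr (Or.inr ⟨hm, hi, h⟩)

lemma mem_isotropicFlags_iff : q ∈ isotropicFlags ω d ↔ IsIsotropic ω q.top :=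
  ⟨fun h => h _, fun h _ u hu v hv =>
    h u (q.mono (Fin.le_last _) hu) v (q.mono (Fin.le_last _) hv)⟩

lemma coord_center (hd : Monotone d) (hp : IsIsotropic ω p.top) : nb.coord p = 0 := by
  funext c
  obtain ⟨⟨j, i⟩, hi, hij⟩ := c
  have ht (i : Fin (finrank ℂ E)) (hi : (i : ℕ) < d (Fin.last r)) : nb.tVec i p = nb.basis i :=
    nb.transversal_center.graphVec_eq (basis_mem hi) fun _ _ => rfl
  have hs : nb.sVec i p = nb.basis i :=
    nb.transversal_center.graphVec_eq (basis_mem (lt_block hi)) fun _ _ => rfl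
  have hne : i ≠ j := by
    rintro rfl
    exact absurd (lt_block hi) (not_lt.2 hij)
  refine (entry_eq _ _).symm.trans ?_
  change entry _ j i = 0
  by_cases hsp : nb.Special j i
  · obtain ⟨m, hm, rfl⟩ := hsp
    rw [entry_coord_special hd hm, ht i hi, ht m hm.2.1]
    exact hp _ (basis_mem hi) _ (basis_mem hm.2.1)
  · by_cases hj : d (Fin.last r) ≤ j
    · rw [entry_coord_of_le hd hi hj hsp, ht i hi, repr_basis, if_neg hne]
    · rw [entry_coord_of_lt hi hij (not_le.1 hj), hs, repr_basis, if_neg hne]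

lemma eventually_transversal : ∀ᶠ q in 𝓝 p, Transversal nb.basis q :=
  isOpen_transversal.eventually_mem nb.transversal_center

variable (nb) [FiniteDimensional ℂ E]

/-- The basis attached to a point of the chart, with the flag that it spans. -/
noncomputable def lift (hd : Monotone d) (x : ChartIndex d (finrank ℂ E) → ℂ) : AdaptedBasis d E :=
  AdaptedBasis.ofBasis hd (dim_le p) (exists_basis_eq_of_span (nb.yVec x) yVec_span).choose

variable {nb}

lemma lift_basis (hd : Monotone d) : ⇑(nb.lift hd x).basis = nb.yVec x :=
  (exists_basis_eq_of_span (nb.yVec x) yVec_span).choose_spec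

lemma yVec_mem (hd : Monotone d) {a : Fin (r + 1)} (hi : (i : ℕ) < d a) :
    nb.yVec x i ∈ (nb.lift hd x).flag.V a := by
  rw [(nb.lift hd x).adapted, lift_basis]
  exact Submodule.subset_span ⟨i, hi, rfl⟩

/-- The top member is spanned by combinations of the `uVec`; counting dimensions, it equals their
span, without inverting the triangular change of family. -/
lemma uVec_mem (hd : Monotone d) (hi : (i : ℕ) < d (Fin.last r)) :
    nb.uVec x i ∈ (nb.lift hd x).flag.top := by
  have h1 : (nb.lift hd x).flag.top ≤ Submodule.span ℂ
      (Set.range fun l : {l : Fin (finrank ℂ E) // (l : ℕ) < d (Fin.last r)} => nb.uVec x l) := by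
    rw [Flag.top, (nb.lift hd x).adapted, lift_basis, Submodule.span_le]
    rintro _ ⟨l, hl, rfl⟩
    have hl' : (l : ℕ) < d (Fin.last r) := hl
    rw [yVec, if_pos hl']
    refine add_mem (Submodule.subset_span ⟨⟨l, hl'⟩, rfl⟩) (sum_mem fun j _ => ?_)
    by_cases hj : d (block d l) ≤ j ∧ (j : ℕ) < d (Fin.last r)
    · exact Submodule.smul_mem _ _ (Submodule.subset_span ⟨⟨j, hj.2⟩, rfl⟩)
    · rw [if_neg hj, zero_smul]
      exact zero_mem _
  have h2 := finrank_range_le_card (R := ℂ)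
    (fun l : {l : Fin (finrank ℂ E) // (l : ℕ) < d (Fin.last r)} => nb.uVec x l)
  have h3 := card_fin_lt (dim_le p (Fin.last r))
  rw [Submodule.eq_of_le_of_finrank_le h1 (h2.trans
    (h3.trans ((nb.lift hd x).flag.finrank_eq _).symm).le)]
  exact Submodule.subset_span ⟨⟨i, hi⟩, rfl⟩

lemma transversal_lift (hd : Monotone d) : Transversal nb.basis (nb.lift hd x).flag := by
  rw [transversal_iff]
  intro a
  have h : (minorMatrix (d := d) nb.basis a (nb.lift hd x).vec).det = 1 := by
    rw [Matrix.det_of_isLowerTriangular]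
    · simp [minorMatrix, AdaptedBasis.vec, lift_basis, repr_yVec_self]
    · intro i j hij
      simp only [minorMatrix, AdaptedBasis.vec, lift_basis, Matrix.of_apply]
      exact repr_yVec_of_lt_of_lt hij
  rw [h]
  exact one_ne_zero

lemma tVec_lift (hd : Monotone d) (hi : (i : ℕ) < d (Fin.last r)) :
    nb.tVec i (nb.lift hd x).flag = nb.uVec x i :=
  (transversal_lift hd).graphVec_eq (uVec_mem hd hi) fun j hj => by
    rw [repr_uVec_of_lt hj, repr_basis]

lemma sVec_lift (hd : Monotone d) (hi : (i : ℕ) < d (Fin.last r)) :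
    nb.sVec i (nb.lift hd x).flag = nb.yVec x i :=
  (transversal_lift hd).graphVec_eq (yVec_mem hd (lt_block hi)) fun j hj => by
    rw [repr_yVec_of_lt hi (hj.trans_le (hd (Fin.le_last _))), repr_basis,
      if_neg (not_le.2 hj), add_zero]

lemma coord_lift (hd : Monotone d) : nb.coord (nb.lift hd x).flag = x := by
  funext c
  obtain ⟨⟨j, i⟩, hi, hij⟩ := c
  refine (entry_eq _ _).symm.trans (Eq.trans ?_ (entry_eq x _))
  change entry _ j i = entry x j i
  by_cases hs : nb.Special j i
  · obtain ⟨m, hm, rfl⟩ := hs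
    rw [entry_coord_special hd hm, tVec_lift hd hm.1, tVec_lift hd hm.2.1, bilin_uVec hm]
  · by_cases hj : d (Fin.last r) ≤ j
    · rw [entry_coord_of_le hd hi hj hs, tVec_lift hd hi, repr_uVec_of_not_special hi hj hs]
    · have hj' := not_le.1 hj
      have hne : i ≠ j := by
        rintro rfl
        exact absurd (lt_block hi) (not_lt.2 hij)
      rw [entry_coord_of_lt hi hij hj', sVec_lift hd hi, repr_yVec_of_lt hi hj', if_pos hij,
        if_neg hne, zero_add]

lemma repr_tVec (hq : Transversal nb.basis q) (hj : (j : ℕ) < d (Fin.last r)) :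
    nb.basis.repr (nb.tVec i q) j = if i = j then 1 else 0 := by
  rw [tVec, repr_graphVec hq hj, repr_basis]

/-- The non-special entries of `tVec` are coordinates of the flag, so the tail has to account only
for the special ones. -/
lemma tVec_eq_wVec_add (hd : Monotone d) (hq : Transversal nb.basis q)
    (hi : (i : ℕ) < d (Fin.last r)) :
    nb.tVec i q = nb.wVec (nb.coord q) i +
      nb.tail (fun m => nb.basis.repr (nb.tVec i q) (nb.e m)) i := by
  refine nb.basis.ext_elem fun j => ?_
  rw [map_add, Finsupp.add_apply]
  by_cases hj : d (Fin.last r) ≤ j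
  · rw [repr_wVec_of_le hi hj]
    by_cases hs : nb.Special j i
    · obtain ⟨m, hm, rfl⟩ := hs
      rw [if_pos ⟨m, hm, rfl⟩, repr_tail_e _ hm, zero_add]
    · rw [if_neg hs, entry_coord_of_le hd hi hj hs, repr_tail_of_not_special _ hs, add_zero]
  · have hj' := not_le.1 hj
    rw [repr_tVec hq hj', repr_wVec_of_lt hj', repr_tail_of_lt _ hj', add_zero]

/-- By `bilin_add_tail` the special entries of `tVec` are its form values minus those of `wVec`, so
form values may replace special entries as coordinates. -/
lemma uVec_coord (hd : Monotone d) (hq : Transversal nb.basis q) (hi : (i : ℕ) < d (Fin.last r)) :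
    nb.uVec (nb.coord q) i = nb.tVec i q := by
  rw [tVec_eq_wVec_add hd hq hi, uVec]
  congr 1
  refine Finset.sum_congr rfl fun m _ => ?_
  by_cases hm : nb.Rel i m
  · have h := bilin_add_tail (nb := nb) (w := nb.wVec (nb.coord q)) (u := fun i => nb.tVec i q)
      (fun i j _ hj => repr_wVec_of_lt hj) (fun i hi => tVec_eq_wVec_add hd hq hi) hm
    beta_reduce
    rw [if_pos hm, if_pos hm, entry_coord_special hd hm, h]
    congr 1
    ring
  · rw [if_neg hm, if_neg hm]

/-- Both vectors lie in the top member, where transversality lets one compare only the first `d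
(Fin.last r)` coordinates. -/
lemma yVec_coord (hd : Monotone d) (hq : Transversal nb.basis q) (hi : (i : ℕ) < d (Fin.last r)) :
    nb.yVec (nb.coord q) i = nb.sVec i q := by
  have hle : q.V (block d i) ≤ q.V (Fin.last r) := q.mono (Fin.le_last _)
  refine hq.eq_of_repr_eq (a := Fin.last r) ?_ (hle (graphVec_mem _ _ _ _)) fun j hj => ?_
  · rw [yVec, if_pos hi]
    refine add_mem ?_ (sum_mem fun j _ => ?_)
    · rw [uVec_coord hd hq hi]
      exact graphVec_mem _ _ _ _
    · by_cases hj : d (block d i) ≤ j ∧ (j : ℕ) < d (Fin.last r)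
      · rw [uVec_coord hd hq hj.2]
        exact Submodule.smul_mem _ _ (graphVec_mem _ _ _ _)
      · rw [if_neg hj, zero_smul]
        exact zero_mem _
  · rw [repr_yVec_of_lt hi hj]
    by_cases hij : d (block d i) ≤ j
    · have hne : i ≠ j := by
        rintro rfl
        exact absurd (lt_block hi) (not_lt.2 hij)
      rw [if_pos hij, entry_coord_of_lt hi hij hj, if_neg hne, zero_add]
    · rw [if_neg hij, sVec, repr_graphVec hq (not_le.1 hij), repr_basis, add_zero]

lemma lift_coord (hd : Monotone d) (hq : Transversal nb.basis q) :
    (nb.lift hd (nb.coord q)).flag = q := by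
  refine Flag.ext (funext fun a => ?_)
  refine Submodule.eq_of_le_of_finrank_eq ?_ ?_
  · rw [(nb.lift hd (nb.coord q)).adapted, lift_basis, Submodule.span_le]
    rintro _ ⟨i, hi, rfl⟩
    have hi' : (i : ℕ) < d a := hi
    rw [yVec_coord hd hq (hi'.trans_le (hd (Fin.le_last a)))]
    exact q.mono (block_le hd hi') (graphVec_mem _ _ _ _)
  · rw [Flag.finrank_eq, Flag.finrank_eq]

lemma vecIn_uVec : VecIn (polyMaps _) fun x => nb.uVec x i :=
  vecIn_wVec.add (vecIn_tail
    (c := fun m x => entry x (nb.e m) i - bilin ω (nb.wVec x i) (nb.wVec x m)) fun _ =>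
    sub_mem (entry_mem_polyMaps _ i) (vecIn_wVec.bilin vecIn_wVec _))

lemma vecIn_yVec : VecIn (polyMaps _) fun x => nb.yVec x i := by
  by_cases hi : (i : ℕ) < d (Fin.last r)
  · simp only [yVec, if_pos hi]
    exact vecIn_uVec.add (VecIn.sum _ fun j _ => VecIn.smul
      (ite_mem (fun _ => entry_mem_polyMaps j i) fun _ => zero_mem _) vecIn_uVec)
  · simp only [yVec, if_neg hi]
    exact vecIn_const _

lemma coord_regular (c : ChartIndex d (finrank ℂ E)) :
    (fun q => nb.coord q c) ∈ regularAt p := by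
  have ht (i : Fin (finrank ℂ E)) : VecIn (regularAlg p) (nb.tVec i) :=
    vecIn_graphVec nb.transversal_center _ _
  have hs (i : Fin (finrank ℂ E)) : VecIn (regularAlg p) (nb.sVec i) :=
    vecIn_graphVec nb.transversal_center _ _
  by_cases h : nb.Special c.1.1 c.1.2
  · simp only [coord, dif_pos h]
    exact mem_regularAlg.1 ((ht _).bilin (ht _) _)
  · by_cases hj : d (Fin.last r) ≤ c.1.1
    · simp only [coord, dif_neg h, if_pos hj]
      exact mem_regularAlg.1 (ht _ (nb.basis.coord _))
    · simp only [coord, dif_neg h, if_neg hj]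
      exact mem_regularAlg.1 (hs _ (nb.basis.coord _))

variable (nb) in
/-- The chart attached to a normal basis. -/
noncomputable def chart (hd : Monotone d) (hp : IsIsotropic ω p.top) :
    Chart p (ChartIndex d (finrank ℂ E)) where
  lift := nb.lift hd
  coord := nb.coord
  lift_poly := fun P hP => mem_polyMaps.1 (comp_mem_of_polyFun (f := fun x => (nb.lift hd x).vec)
    (vecIn_pi fun j => by
      simp only [AdaptedBasis.vec, lift_basis]
      exact vecIn_yVec) hP)
  coord_regular := coord_regular
  coord_lift := fun _ => coord_lift hd
  lift_coord := eventually_transversal.mono fun _ hq => lift_coord hd hq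
  coord_self := coord_center hd hp

variable (nb) in
/-- The coordinates that vanish on isotropic flags. -/
def specialSet : Set (ChartIndex d (finrank ℂ E)) := {c | nb.Special c.1.1 c.1.2}

lemma eq_sum_tVec (hq : Transversal nb.basis q) {y : E} (hy : y ∈ q.top) :
    y = ∑ i : Fin (finrank ℂ E),
      (if (i : ℕ) < d (Fin.last r) then nb.basis.repr y i else 0) • nb.tVec i q := by
  refine hq.eq_of_repr_eq hy (sum_mem fun i _ =>
    Submodule.smul_mem _ _ (graphVec_mem _ _ _ _)) fun j hj => ?_
  simp only [map_sum, map_smul, Finsupp.coe_finsetSum, Finset.sum_apply, Finsupp.smul_apply,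
    smul_eq_mul, repr_tVec hq hj]
  rw [Finset.sum_eq_single j]
  · simp [hj]
  · intro i _ hi
    rw [if_neg hi, mul_zero]
  · simp

/-- The `tVec` span the top member; by skew-symmetry their values on ordered pairs decide isotropy,
and these are the special coordinates. -/
lemma mem_isotropicFlags_iff_coord (hd : Monotone d) (hq : Transversal nb.basis q) :
    q ∈ isotropicFlags ω d ↔ ∀ c ∈ nb.specialSet, nb.coord q c = 0 := by
  rw [mem_isotropicFlags_iff]
  constructor
  · intro h c hc
    obtain ⟨m, hm, hmc⟩ := hc
    rw [← entry_eq (nb.coord q), ← hmc, entry_coord_special hd hm]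
    exact h _ (graphVec_mem _ _ _ _) _ (graphVec_mem _ _ _ _)
  · intro h
    have hrel (i m : Fin (finrank ℂ E)) (him : nb.Rel i m) :
        bilin ω (nb.tVec i q) (nb.tVec m q) = 0 := by
      have h0 : (i : ℕ) < d (Fin.last r) ∧ d (block d i) ≤ nb.e m :=
        ⟨him.1, (hd (Fin.le_last _)).trans him.le_e⟩
      have h1 := h ⟨(nb.e m, i), h0⟩ ⟨m, him, rfl⟩
      rw [← entry_eq (nb.coord q)] at h1
      rwa [← entry_coord_special hd him]
    have hall (i m : Fin (finrank ℂ E)) (hi : (i : ℕ) < d (Fin.last r))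
        (hm : (m : ℕ) < d (Fin.last r)) : bilin ω (nb.tVec i q) (nb.tVec m q) = 0 := by
      rcases nb.rel_or_eq_or_rel hi hm with h | rfl | h
      · exact hrel i m h
      · exact bilin_self _ _
      · rw [bilin_swap, hrel m i h, neg_zero]
    intro u hu v hv
    rw [← bilin_apply, eq_sum_tVec hq hu, eq_sum_tVec hq hv]
    simp only [map_sum, map_smul, LinearMap.sum_apply, LinearMap.smul_apply, smul_eq_mul]
    refine Finset.sum_eq_zero fun i _ => ?_
    by_cases hi : (i : ℕ) < d (Fin.last r)
    · rw [Finset.mul_sum]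
      refine Finset.sum_eq_zero fun m _ => ?_
      by_cases hm : (m : ℕ) < d (Fin.last r)
      · simp [hall, hi, hm]
      · simp [hm]
    · simp [hi]

end NormalBasis

/-! ### Counting the special coordinates -/

section Codim

variable {r : ℕ} {d : Fin (r + 1) → ℕ} {E : Type*} [AddCommGroup E] [Module ℂ E]
  {ω : E [⋀^Fin 2]→ₗ[ℂ] ℂ} {p : Flag d E}

/-- The number of coordinates that vanish on isotropic flags. -/
lemma NormalBasis.ncard_specialSet [FiniteDimensional ℂ E] (nb : NormalBasis ω p)
    (hd : Monotone d) :
    nb.specialSet.ncard = d (Fin.last r) * (d (Fin.last r) - 1) / 2 := by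
  classical
  set k := d (Fin.last r) with hk
  let A : Finset (Fin (finrank ℂ E)) := Finset.univ.filter fun i => (i : ℕ) < k
  let R : Finset (Fin (finrank ℂ E) × Fin (finrank ℂ E)) :=
    Finset.univ.filter fun c => nb.Rel c.1 c.2
  have hA : A.card = k := by
    rw [← Fintype.card_subtype]
    exact card_fin_lt (dim_le p (Fin.last r))
  have hswap : (R.map (Equiv.prodComm _ _).toEmbedding).card = R.card := Finset.card_map _
  have hdisj : Disjoint R (R.map (Equiv.prodComm _ _).toEmbedding) := by
    rw [Finset.disjoint_left]
    rintro ⟨i, m⟩ h1 h2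
    simp only [R, Finset.mem_map_equiv, Finset.mem_filter, Finset.mem_univ, true_and,
      Equiv.prodComm_symm, Equiv.prodComm_apply, Prod.swap] at h1 h2
    exact lt_asymm h1.2.2 h2.2.2
  -- The related pairs and their reversals partition the k² - k ordered pairs of distinct indices
  -- below k.
  have hunion : R ∪ R.map (Equiv.prodComm _ _).toEmbedding = A.offDiag := by
    ext ⟨i, m⟩
    simp only [R, A, Finset.mem_union, Finset.mem_map_equiv, Finset.mem_filter, Finset.mem_univ,
      true_and, Equiv.prodComm_symm, Equiv.prodComm_apply, Prod.swap, Finset.mem_offDiag]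
    constructor
    · rintro (h | h)
      · exact ⟨h.1, h.2.1, fun him => by subst him; exact lt_irrefl _ h.2.2⟩
      · exact ⟨h.2.1, h.1, fun him => by subst him; exact lt_irrefl _ h.2.2⟩
    · rintro ⟨h1, h2, h3⟩
      rcases nb.rel_or_eq_or_rel h1 h2 with h | h | h
      · exact Or.inl h
      · exact absurd h h3
      · exact Or.inr h
  have hcard := Finset.card_union_of_disjoint hdisj
  rw [hunion, hswap, Finset.offDiag_card, hA] at hcard
  have hR : (R : Set (Fin (finrank ℂ E) × Fin (finrank ℂ E))).ncard = nb.specialSet.ncard := by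
    have hmem (a : Fin (finrank ℂ E) × Fin (finrank ℂ E)) (ha : a ∈ (R : Set _)) :
        nb.Rel a.1 a.2 := by simpa [R] using ha
    refine Set.ncard_congr (fun a ha => ⟨(nb.e a.2, a.1),
      (hmem a ha).1, (hd (Fin.le_last _)).trans (hmem a ha).le_e⟩) ?_ ?_ ?_
    · exact fun a ha => ⟨a.2, hmem a ha, rfl⟩
    · intro a b ha hb hab
      have h1 := congrArg Subtype.val hab
      exact Prod.ext (congrArg Prod.snd h1)
        ((hmem a ha).e_injective (hmem b hb) (congrArg Prod.fst h1))
    · rintro ⟨⟨j, i⟩, hc⟩ ⟨m, hm, hmj⟩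
      exact ⟨(i, m), Finset.mem_coe.2 (Finset.mem_filter.2 ⟨Finset.mem_univ _, hm⟩),
        Subtype.ext (Prod.ext hmj rfl)⟩
  rw [← hR, Set.ncard_coe_finset]
  have h2 : k * (k - 1) = k * k - k := Nat.mul_sub_one k k
  omega

end Codim

/-! ### The section of `Λ² T*` defined by a skew-form -/

section Section

variable {r : ℕ} {d : Fin (r + 1) → ℕ} {E : Type*} [AddCommGroup E] [Module ℂ E]
  (ω : E [⋀^Fin 2]→ₗ[ℂ] ℂ)

lemma formSection_apply (q : Flag d E) (u v : q.top) :
    formSection ω q ![u, v] = bilin ω u v := by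
  rw [formSection, AlternatingMap.compLinearMap_apply, bilin_apply]
  congr 1
  ext i
  fin_cases i <;> rfl

theorem isRegularForm_formSection [FiniteDimensional ℂ E] (p : Flag d E) :
    IsRegularForm (formSection ω) p := by
  intro s t hs ht
  simp only [formSection_apply]
  exact mem_regularAlg.1 (VecIn.bilin (𝒜 := regularAlg p) (f := fun q => (s q : E))
    (g := fun q => (t q : E)) hs ht (bilin ω))

theorem isotropicFlags_eq_zeros : isotropicFlags ω d = {p : Flag d E | formSection ω p = 0} := by
  ext p
  rw [NormalBasis.mem_isotropicFlags_iff]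
  constructor
  · intro h
    refine AlternatingMap.ext fun v => ?_
    have h1 : v = ![v 0, v 1] := by ext i; fin_cases i <;> rfl
    rw [h1, formSection_apply]
    exact h _ (v 0).2 _ (v 1).2
  · intro h u hu v hv
    have h1 := formSection_apply ω p ⟨u, hu⟩ ⟨v, hv⟩
    rw [show formSection ω p = 0 from h] at h1
    exact h1.symm

variable {ω} {p : Flag d E} [FiniteDimensional ℂ E]

lemma NormalBasis.eventually_mem_iff (nb : NormalBasis ω p) (hd : Monotone d)
    (hp : IsIsotropic ω p.top) : ∀ᶠ q in 𝓝 p, q ∈ isotropicFlags ω d ↔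
      ∀ c ∈ nb.specialSet, (nb.chart hd hp).coord q c = 0 :=
  eventually_transversal.mono fun _ hq => mem_isotropicFlags_iff_coord hd hq

theorem isRegularLocalRing_isotropicFlags (hω : formRank ω + 1 = finrank ℂ E) (hd : Monotone d)
    (hp : p ∈ isotropicFlags ω d) :
    IsRegularLocalRing (localRing (isotropicFlags ω d) p) ∧
      ringKrullDim (localRing (isotropicFlags ω d) p) +
          ((d (Fin.last r) * (d (Fin.last r) - 1) / 2 : ℕ) : WithBot ℕ∞) =
        ringKrullDim (localRing (Set.univ : Set (Flag d E)) p) := by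
  have hp' : IsIsotropic ω p.top := hp _
  obtain ⟨nb⟩ := exists_normalBasis ω hω hd p hp'
  rw [← nb.ncard_specialSet hd]
  exact (nb.chart hd hp').isRegularLocalRing_and_ringKrullDim_add (nb.eventually_mem_iff hd hp')

/-- The special coordinates generate the vanishing ideal and are contractions of the section with
the regular sections `tVec`. Conversely, every contraction vanishes on isotropic flags. -/
theorem vanishingIdeal_eq_zeroSchemeIdeal (hω : formRank ω + 1 = finrank ℂ E) (hd : Monotone d)
    (hp : p ∈ isotropicFlags ω d) :
    vanishingIdeal (isotropicFlags ω d) p = zeroSchemeIdeal (formSection ω) p := by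
  have hp' : IsIsotropic ω p.top := hp _
  obtain ⟨nb⟩ := exists_normalBasis ω hω hd p hp'
  refine le_antisymm ?_ ?_
  · refine (nb.chart hd hp').vanishingIdeal_le (nb.eventually_mem_iff hd hp') _ ?_
    intro c hc g hg
    obtain ⟨m, hm, hmc⟩ := hc
    refine Ideal.subset_span ⟨fun q => ⟨nb.tVec c.1.2 q, graphVec_mem _ _ _ _⟩,
      fun q => ⟨nb.tVec m q, graphVec_mem _ _ _ _⟩, vecIn_graphVec nb.transversal_center _ _,
      vecIn_graphVec nb.transversal_center _ _, hg.trans ?_⟩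
    congr 1
    funext q
    rw [formSection_apply]
    change nb.coord q c = _
    rw [← entry_eq (nb.coord q), ← hmc, NormalBasis.entry_coord_special hd hm]
  · rw [zeroSchemeIdeal, Ideal.span_le]
    rintro g ⟨s, t, hs, ht, hg⟩
    refine ⟨_, isRegularForm_formSection ω p s t hs ht, hg, ?_⟩
    filter_upwards [self_mem_nhdsWithin] with q hq
    rw [formSection_apply]
    exact hq _ _ (s q).2 _ (t q).2

variable (ω) in
-- A flag that is not isotropic has two vectors of an adapted basis, in its top member, on which the
-- form is nonzero; this is a polynomial inequality in the basis.
theorem isClosed_isotropicFlags : IsClosed (isotropicFlags ω d) := by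
  rw [← isOpen_compl_iff]
  refine isOpen_flag_of_exists_polyFun fun x hx => ?_
  have hex : ∃ i j : Fin (finrank ℂ E), (i : ℕ) < d (Fin.last r) ∧ (j : ℕ) < d (Fin.last r) ∧
      bilin ω (x.basis i) (x.basis j) ≠ 0 := by
    by_contra! h
    refine hx (NormalBasis.mem_isotropicFlags_iff.2 fun u hu v hv => ?_)
    obtain ⟨c, rfl⟩ := x.mem_V_iff.1 hu
    obtain ⟨c', rfl⟩ := x.mem_V_iff.1 hv
    rw [← bilin_apply]
    simp only [map_sum, map_smul, LinearMap.sum_apply, LinearMap.smul_apply]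
    refine Finset.sum_eq_zero fun j _ => ?_
    rw [Finset.sum_eq_zero fun i _ => by rw [h _ _ i.2 j.2, smul_zero], smul_zero]
  obtain ⟨i, j, hi, hj, hij⟩ := hex
  refine ⟨fun w => bilin ω (w i) (w j), (vecIn_polyFun i).bilin (vecIn_polyFun j) _, hij, ?_⟩
  intro y hy hmem
  have h1 (i : Fin (finrank ℂ E)) (hi : (i : ℕ) < d (Fin.last r)) : y.basis i ∈ y.flag.top := by
    rw [Flag.top, y.adapted]
    exact Submodule.subset_span ⟨i, hi, rfl⟩
  exact hy (hmem _ _ (h1 i hi) _ (h1 j hj))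

end Section

/-! ### Existence of isotropic flags -/

section Existence

variable {E : Type*} [AddCommGroup E] [Module ℂ E] [FiniteDimensional ℂ E]
  (ω : E [⋀^Fin 2]→ₗ[ℂ] ℂ)

/-- The orthogonal of an isotropic `W` of dimension k has dimension at least dim E - k. This exceeds
k when 2(k + 1) ≤ dim E + 1, so `W` can be enlarged by an orthogonal vector outside it. -/
theorem exists_isotropic_submodule (k : ℕ) (hk : 2 * k ≤ finrank ℂ E + 1) :
    ∃ W : Submodule ℂ E, finrank ℂ W = k ∧ IsIsotropic ω W := by
  induction k with
  | zero =>
    refine ⟨⊥, finrank_bot ℂ E, fun u hu v _ => ?_⟩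
    rw [(Submodule.mem_bot ℂ).1 hu, ← bilin_apply, map_zero]
    rfl
  | succ k ih =>
    obtain ⟨W, hWk, hW⟩ := ih (by omega)
    let f : E →ₗ[ℂ] Dual ℂ W := W.subtype.dualMap ∘ₗ (bilin ω).flip
    have h1 := LinearMap.finrank_range_add_finrank_ker f
    have h2 : finrank ℂ (LinearMap.range f) ≤ finrank ℂ W :=
      (Submodule.finrank_le _).trans Subspace.dual_finrank_eq.le
    have h3 : ¬ LinearMap.ker f ≤ W := fun h => by
      have := Submodule.finrank_mono h
      omega
    obtain ⟨v, hv, hvW⟩ := SetLike.not_le_iff_exists.1 h3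
    have hv' (w : E) (hw : w ∈ W) : bilin ω w v = 0 :=
      LinearMap.congr_fun (LinearMap.mem_ker.1 hv) ⟨w, hw⟩
    refine ⟨W ⊔ Submodule.span ℂ {v}, ?_, ?_⟩
    · have hv0 : v ≠ 0 := fun h => hvW (h ▸ zero_mem _)
      have h4 := Submodule.finrank_sup_add_finrank_inf_eq W (Submodule.span ℂ {v})
      have h5 : W ⊓ Submodule.span ℂ {v} = ⊥ := by
        rw [← disjoint_iff]
        exact (Submodule.disjoint_span_singleton' hv0).2 hvW
      rw [h5, finrank_bot, finrank_span_singleton hv0] at h4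
      omega
    · intro u hu u' hu'
      obtain ⟨w, hw, y, hy, rfl⟩ := Submodule.mem_sup.1 hu
      obtain ⟨w', hw', y', hy', rfl⟩ := Submodule.mem_sup.1 hu'
      obtain ⟨a, rfl⟩ := Submodule.mem_span_singleton.1 hy
      obtain ⟨a', rfl⟩ := Submodule.mem_span_singleton.1 hy'
      have h6 : bilin ω w w' = 0 := hW _ hw _ hw'
      have h7 : bilin ω v w' = 0 := by rw [bilin_swap, hv' w' hw', neg_zero]
      rw [← bilin_apply]
      simp [h6, h7, hv' w hw, bilin_self]

theorem isotropicFlags_nonempty {r : ℕ} {d : Fin (r + 1) → ℕ} (hd : Monotone d)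
    (hk : 2 * d (Fin.last r) ≤ finrank ℂ E + 1) : (isotropicFlags ω d).Nonempty := by
  obtain ⟨W, hWk, hW⟩ := exists_isotropic_submodule ω _ hk
  let W' : Flag (r := 0) (fun _ => d (Fin.last r)) E := ⟨fun _ => W, monotone_const, fun _ => hWk⟩
  obtain ⟨x, hx⟩ := exists_adaptedBasis W'
  have hle (i : Fin (r + 1)) : d i ≤ finrank ℂ E :=
    (hd (Fin.le_last i)).trans (hWk ▸ Submodule.finrank_le _)
  refine ⟨(AdaptedBasis.ofBasis hd hle x.basis).flag, NormalBasis.mem_isotropicFlags_iff.2 ?_⟩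
  have h1 : (AdaptedBasis.ofBasis hd hle x.basis).flag.top = W := by
    have h2 := x.adapted 0
    rw [hx] at h2
    exact h2.symm
  rwa [h1]

end Existence

/-! ### Genericity of the forms of maximal rank -/

section Generic

variable {E : Type*} [AddCommGroup E] [Module ℂ E]

/-- The matrix of values of a form on two families of vectors. -/
def gram (θ : E [⋀^Fin 2]→ₗ[ℂ] ℂ) {m : ℕ} (u w : Fin m → E) : Matrix (Fin m) (Fin m) ℂ :=
  Matrix.of fun i j => bilin θ (u i) (w j)

lemma det_gram_mem_polyFun {m : ℕ} (u w : Fin m → E) :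
    (fun θ : E [⋀^Fin 2]→ₗ[ℂ] ℂ => (gram θ u w).det) ∈ polyFun (E [⋀^Fin 2]→ₗ[ℂ] ℂ) :=
  det_mem fun i j => dual_mem_polyFun
    { toFun := fun θ => bilin θ (u i) (w j)
      map_add' := fun _ _ => rfl
      map_smul' := fun _ _ => rfl }

variable [FiniteDimensional ℂ E]

/-- This expresses a lower bound on the rank by nonvanishing of polynomials in the form, whence
openness and density. -/
lemma le_formRank_iff (θ : E [⋀^Fin 2]→ₗ[ℂ] ℂ) (m : ℕ) :
    m ≤ formRank θ ↔ ∃ u w : Fin m → E, (gram θ u w).det ≠ 0 := by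
  rw [formRank_eq]
  constructor
  · intro h
    obtain ⟨φ, hφ⟩ := exists_linearIndependent_of_le_finrank h
    choose u hu using fun i => (φ i).2
    have hli : LinearIndependent ℂ fun i => bilin θ (u i) := by
      simp only [hu]
      exact hφ.map' (LinearMap.range (bilin θ)).subtype (Submodule.ker_subtype _)
    let ev : E →ₗ[ℂ] Fin m → ℂ := LinearMap.pi fun i => bilin θ (u i)
    -- A functional vanishing on the image of `ev` would be a linear relation among the independent
    -- functionals.
    have hev : LinearMap.range ev = ⊤ := by
      by_contra hne
      obtain ⟨f, hf0, hf⟩ := Submodule.exists_le_ker_of_lt_top _ (lt_top_iff_ne_top.2 hne)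
      have hsum : ∑ i, f (Pi.single i 1) • bilin θ (u i) = 0 := by
        ext y
        have h1 : f (ev y) = 0 := hf ⟨y, rfl⟩
        rw [LinearMap.pi_apply_eq_sum_univ f] at h1
        rw [LinearMap.sum_apply, LinearMap.zero_apply, ← h1]
        refine Finset.sum_congr rfl fun i _ => ?_
        rw [LinearMap.smul_apply, smul_eq_mul, smul_eq_mul, mul_comm]
        congr 2
        ext j
        simp [Pi.single_apply, eq_comm]
      have h2 := Fintype.linearIndependent_iff.1 hli _ hsum
      refine hf0 (LinearMap.pi_ext' fun i => LinearMap.ext_ring ?_)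
      simpa using h2 i
    choose w hw using fun j => LinearMap.range_eq_top.1 hev (Pi.single j 1)
    refine ⟨u, w, ?_⟩
    have h3 : gram θ u w = 1 := by
      ext i j
      have := congrFun (hw j) i
      simpa [ev, gram, Matrix.one_apply, Pi.single_apply] using this
    rw [h3, Matrix.det_one]
    exact one_ne_zero
  · rintro ⟨u, w, h⟩
    have hli : LinearIndependent ℂ fun i => (⟨bilin θ (u i), u i, rfl⟩ :
        LinearMap.range (bilin θ)) := by
      rw [Fintype.linearIndependent_iff]
      intro c hc
      have h1 : Matrix.vecMul c (gram θ u w) = 0 := by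
        ext j
        have h2 := LinearMap.congr_fun (congrArg Subtype.val hc) (w j)
        simpa [Matrix.vecMul, dotProduct, gram] using! h2
      exact congrFun (Matrix.eq_zero_of_vecMul_eq_zero h h1)
    simpa using hli.fintype_card_le_finrank

/-- A skew-form on an odd-dimensional space is degenerate. -/
lemma formRank_lt_of_odd (θ : E [⋀^Fin 2]→ₗ[ℂ] ℂ) (hodd : Odd (finrank ℂ E)) :
    formRank θ < finrank ℂ E := by
  let b := finBasis ℂ E
  have hdet : (gram θ b b).det = 0 := by
    have h1 : (gram θ b b).transpose = -gram θ b b := by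
      ext i j
      exact bilin_swap θ _ _
    have h2 := Matrix.det_transpose (gram θ b b)
    rw [h1, Matrix.det_neg, Fintype.card_fin, hodd.neg_one_pow] at h2
    linear_combination (-1 / 2 : ℂ) * h2
  obtain ⟨c, hc0, hc⟩ := Matrix.exists_vecMul_eq_zero_iff.2 hdet
  have hker : ∑ i, c i • b i ∈ LinearMap.ker (bilin θ) := by
    rw [LinearMap.mem_ker]
    refine b.ext fun j => ?_
    have := congrFun hc j
    simpa [Matrix.vecMul, dotProduct, gram] using! this
  have hne : LinearMap.ker (bilin θ) ≠ ⊥ := by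
    intro h
    rw [h, Submodule.mem_bot] at hker
    exact hc0 (funext (Fintype.linearIndependent_iff.1 b.linearIndependent c hker))
  have h1 := LinearMap.finrank_range_add_finrank_ker (bilin θ)
  have h2 : finrank ℂ (LinearMap.ker (bilin θ)) ≠ 0 := fun h => hne (Submodule.finrank_eq_zero.1 h)
  rw [formRank_eq]
  omega

lemma isOpen_le_formRank (m : ℕ) : IsOpen[zariskiTopology (E [⋀^Fin 2]→ₗ[ℂ] ℂ)]
    {θ : E [⋀^Fin 2]→ₗ[ℂ] ℂ | m ≤ formRank θ} := by
  let := zariskiTopology (E [⋀^Fin 2]→ₗ[ℂ] ℂ)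
  rw [isOpen_iff_forall_mem_open]
  intro θ hθ
  obtain ⟨u, w, h⟩ := (le_formRank_iff θ m).1 hθ
  exact ⟨_, fun θ' h' => (le_formRank_iff θ' m).2 ⟨u, w, h'⟩,
    isOpen_ne_zero (det_gram_mem_polyFun u w), h⟩

/-- Two polynomial functions, neither of which is identically zero, have a common point where
they do not vanish. -/
lemma exists_mul_ne_zero {W : Type*} [AddCommGroup W] [Module ℂ W] {P Q : W → ℂ}
    (hP : P ∈ polyFun W) (hQ : Q ∈ polyFun W) {a b : W} (ha : P a ≠ 0) (hb : Q b ≠ 0) :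
    ∃ c, P c ≠ 0 ∧ Q c ≠ 0 := by
  -- Restriction to the line from `a` (t = 0) to `b` (t = 1) reduces the claim to two nonzero
  -- polynomials in one variable, whose product is nonzero.
  let line : (Unit → ℂ) → W := fun t => a + t () • (b - a)
  have hline : VecIn (polyMaps Unit) line :=
    (vecIn_const a).add ((vecIn_const (b - a)).smul (apply_mem_polyMaps ()))
  obtain ⟨P', hP'⟩ := mem_polyMaps.1 (comp_mem_of_polyFun hline hP)
  obtain ⟨Q', hQ'⟩ := mem_polyMaps.1 (comp_mem_of_polyFun hline hQ)
  have hP0 : P' ≠ 0 := by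
    rintro rfl
    have := hP' 0
    simp [line, ha] at this
  have hQ0 : Q' ≠ 0 := by
    rintro rfl
    have := hQ' 1
    simp [line, hb] at this
  by_contra! h
  refine mul_ne_zero hP0 hQ0 (MvPolynomial.funext fun t => ?_)
  rw [map_mul, map_zero, ← hP', ← hQ', mul_eq_zero]
  exact or_iff_not_imp_left.2 (h (line t))

lemma dense_le_formRank {m : ℕ} (ω : E [⋀^Fin 2]→ₗ[ℂ] ℂ) (hω : m ≤ formRank ω) :
    @Dense (E [⋀^Fin 2]→ₗ[ℂ] ℂ) (zariskiTopology (E [⋀^Fin 2]→ₗ[ℂ] ℂ))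
      {θ : E [⋀^Fin 2]→ₗ[ℂ] ℂ | m ≤ formRank θ} := by
  let := zariskiTopology (E [⋀^Fin 2]→ₗ[ℂ] ℂ)
  rw [dense_iff_inter_open]
  rintro U hU ⟨θ, hθ⟩
  obtain ⟨P, hP, hPθ, hPU⟩ := exists_polyFun_of_isOpen hU hθ
  obtain ⟨u, w, h⟩ := (le_formRank_iff ω m).1 hω
  obtain ⟨c, hc1, hc2⟩ := exists_mul_ne_zero hP (det_gram_mem_polyFun u w) hPθ h
  exact ⟨c, hPU c hc1, (le_formRank_iff c m).2 ⟨u, w, hc2⟩⟩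

end Generic

end OddSymplectic

theorem mainTheorem6 (n : ℕ) {E : Type*} [AddCommGroup E] [Module ℂ E]
    (hE : Module.finrank ℂ E = 2 * n + 1)
    (ω : E [⋀^Fin 2]→ₗ[ℂ] ℂ) (hω : OddSymplectic.formRank ω = 2 * n)
    (r : ℕ) (d : Fin (r + 1) → ℕ) (hd : StrictMono d) (hd_one : 1 ≤ d 0)
    (hd_le : d (Fin.last r) ≤ n + 1) :
    -- the isotropic flags form a nonempty Zariski closed subset of the flag manifold
    IsClosed (OddSymplectic.isotropicFlags ω d) ∧
    (OddSymplectic.isotropicFlags ω d).Nonempty ∧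
    -- which is smooth, of codimension `d_r (d_r - 1) / 2` at every point
    (∀ p ∈ OddSymplectic.isotropicFlags ω d,
      IsRegularLocalRing (OddSymplectic.localRing (OddSymplectic.isotropicFlags ω d) p) ∧
      ringKrullDim (OddSymplectic.localRing (OddSymplectic.isotropicFlags ω d) p) +
          ((d (Fin.last r) * (d (Fin.last r) - 1) / 2 : ℕ) : WithBot ℕ∞) =
        ringKrullDim (OddSymplectic.localRing (Set.univ : Set (OddSymplectic.Flag d E)) p)) ∧
    -- it is the scheme of zeros of the section of `Λ² T*` defined by `ω`
    (∀ p : OddSymplectic.Flag d E,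
      OddSymplectic.IsRegularForm (OddSymplectic.formSection ω) p) ∧
    OddSymplectic.isotropicFlags ω d =
      {p : OddSymplectic.Flag d E | OddSymplectic.formSection ω p = 0} ∧
    (∀ p ∈ OddSymplectic.isotropicFlags ω d,
      OddSymplectic.vanishingIdeal (OddSymplectic.isotropicFlags ω d) p =
        OddSymplectic.zeroSchemeIdeal (OddSymplectic.formSection ω) p) ∧
    -- and `ω` is generic: forms of its rank are a Zariski open dense subset of `Λ² E*`
    IsOpen[OddSymplectic.zariskiTopology (E [⋀^Fin 2]→ₗ[ℂ] ℂ)]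
      {θ : E [⋀^Fin 2]→ₗ[ℂ] ℂ | OddSymplectic.formRank θ = 2 * n} ∧
    @Dense (E [⋀^Fin 2]→ₗ[ℂ] ℂ)
      (OddSymplectic.zariskiTopology (E [⋀^Fin 2]→ₗ[ℂ] ℂ))
      {θ : E [⋀^Fin 2]→ₗ[ℂ] ℂ | OddSymplectic.formRank θ = 2 * n} := by
  have : FiniteDimensional ℂ E := FiniteDimensional.of_finrank_pos (by omega)
  have hω' : OddSymplectic.formRank ω + 1 = finrank ℂ E := by omega
  -- In odd dimension 2n + 1 the rank is at most 2n, so having rank 2n is the open condition of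
  -- having rank at least 2n.
  have hgen : {θ : E [⋀^Fin 2]→ₗ[ℂ] ℂ | OddSymplectic.formRank θ = 2 * n} =
      {θ : E [⋀^Fin 2]→ₗ[ℂ] ℂ | 2 * n ≤ OddSymplectic.formRank θ} := by
    ext θ
    have := OddSymplectic.formRank_lt_of_odd θ ⟨n, hE⟩
    simp only [Set.mem_ofPred_eq]
    omega
  rw [hgen]
  exact ⟨OddSymplectic.isClosed_isotropicFlags ω,
    OddSymplectic.isotropicFlags_nonempty ω hd.monotone (by omega),
    fun p hp => OddSymplectic.isRegularLocalRing_isotropicFlags hω' hd.monotone hp,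
    OddSymplectic.isRegularForm_formSection ω,
    OddSymplectic.isotropicFlags_eq_zeros ω,
    fun p hp => OddSymplectic.vanishingIdeal_eq_zeroSchemeIdeal hω' hd.monotone hp,
    OddSymplectic.isOpen_le_formRank _, OddSymplectic.dense_le_formRank ω hω.ge⟩
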